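/- Let $C$ be a field of characteristic $0$, let $\boldsymbol x=(x_1,\dots,x_m)$ and $\boldsymbol t=(t_1,\dots,t_k)$ be variables, and let $\mathbb O_{\boldsymbol x,\boldsymbol t}=C(\boldsymbol x,\boldsymbol t)\langle\boldsymbol\partial_{\boldsymbol x},\boldsymbol\partial_{\boldsymbol t}\rangle$ be the purely differential Ore algebra: its elements are the finite sums $\sum_{\boldsymbol\alpha} c_{\boldsymbol\alpha}\boldsymbol\partial^{\boldsymbol\alpha}$ with $c_{\boldsymbol\alpha}\in C(\boldsymbol x,\boldsymbol t)$, there is one generator $\partial_v$ for each variable $v$, the generators commute with each other, and $\partial_v a=a\,\partial_v+\partial a/\partial v$ for $a\in C(\boldsymbol x,\boldsymbol t)$. Define $\mathbb O_{\boldsymbol x}=C(\boldsymbol x)\langle\boldsymbol\partial_{\boldsymbol x}\rangle\subset\mathbb O_{\boldsymbol x,\boldsymbol t}$ in the same way. Definitions. * For an Ore algebra $R$ with coefficient field $K$, let $R^{(s)}$ be the space of its elements of total degree at most $s$ in the generators. A left ideal $I$ of $R$ has dimension $d$ if, for all large $s$, its Hilbert function $\dim_K\bigl(R^{(s)}/(I\cap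 R^{(s)})\bigr)$ is equal to a polynomial in $s$ of degree $d$. (The zero polynomial, which occurs only for $I=R$, is given the degree $0$.) * A monomial order is graded if it compares total degrees first. * A left ideal $I$ of $\mathbb O_{\boldsymbol x,\boldsymbol t}$ has polynomial growth $p$ if there are a graded monomial order and nonzero polynomials $P_s\in C[\boldsymbol x,\boldsymbol t]$, $s\in\mathbb N$, such that for all $s$ and all $\boldsymbol\alpha$ with $|\boldsymbol\alpha|\le s$ the normal form of $P_s\,\boldsymbol\partial^{\boldsymbol\alpha}$ with respect to a Gröbner basis of $I$ for this order has its coefficients in $C(\boldsymbol x)[\boldsymbol t]$, and the degrees of these coefficients with respect to $\boldsymbol t$ are $O(s^p)$ as $s\to\infty$, uniformly in $\boldsymbol\alpha$. * The telescoping of $I$ is the left ideal $T_{\boldsymbol t}(I)=\bigl(I+\partial_{t_1}\mathbb O_{\boldsymbol x,\boldsymbol t}+\dots+\partial_{t_k}\mathbb O_{\boldsymbol x,\boldsymbol t}\bigr)\cap\mathbb O_{\boldsymbol x}$ of $\mathbb O_{\boldsymbol x}$. Proposition. Let $I$ be a left ideal of $\mathbb O_{\boldsymbol x,\boldsymbol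 t}$ of dimension $0$ (that is, a $\partial$-finite ideal). Then $I$ has polynomial growth $1$. Moreover, $T_{\boldsymbol t}(I)$ has dimension $0$, as a left ideal of $\mathbb O_{\boldsymbol x}$ (closure of holonomic functions under definite integration). -/

import Mathlib

noncomputable section

namespace DiffOreGrowth

/-! ### Rational functions and partial derivatives -/

/-- The field `C(x_i : i ∈ σ)` of rational functions. -/
abbrev MvRat (C σ : Type*) [Field C] : Type _ := FractionRing (MvPolynomial σ C)

section PartialDerivative

variable {C σ : Type*} [Field C]

/-- `p ↦ p + ε ∂p/∂x_i`, with values in the dual numbers over `C(x)`. -/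
def taylorPoly (i : σ) : MvPolynomial σ C →+* TrivSqZeroExt (MvRat C σ) (MvRat C σ) where
  toFun p := TrivSqZeroExt.inl (algebraMap _ (MvRat C σ) p)
    + TrivSqZeroExt.inr (algebraMap _ (MvRat C σ) (MvPolynomial.pderiv i p))
  map_one' := by ext <;> simp [-Derivation.map_algebraMap]
  map_zero' := by ext <;> simp
  map_add' p q := by
    ext
    · simp only [TrivSqZeroExt.fst_add, TrivSqZeroExt.fst_inl, TrivSqZeroExt.fst_inr, map_add,
        add_zero]
    · simp only [TrivSqZeroExt.snd_add, TrivSqZeroExt.snd_inl, TrivSqZeroExt.snd_inr, map_add,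
        zero_add]
  map_mul' p q := by
    ext
    · simp only [TrivSqZeroExt.fst_add, TrivSqZeroExt.fst_inl, TrivSqZeroExt.fst_inr, map_mul,
        add_zero, TrivSqZeroExt.fst_mul]
    · simp only [TrivSqZeroExt.snd_add, TrivSqZeroExt.snd_inl, TrivSqZeroExt.snd_inr, map_add,
        zero_add, TrivSqZeroExt.snd_mul, TrivSqZeroExt.fst_add, TrivSqZeroExt.fst_inl,
        TrivSqZeroExt.fst_inr, add_zero, Derivation.leibniz, smul_eq_mul, map_mul,
        op_smul_eq_smul]

theorem fst_taylorPoly (i : σ) (p : MvPolynomial σ C) :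
    (taylorPoly i p).fst = algebraMap _ (MvRat C σ) p := by
  simp [taylorPoly]

theorem snd_taylorPoly (i : σ) (p : MvPolynomial σ C) :
    (taylorPoly i p).snd = algebraMap _ (MvRat C σ) (MvPolynomial.pderiv i p) := by
  change (TrivSqZeroExt.inl (algebraMap _ (MvRat C σ) p)
    + TrivSqZeroExt.inr (algebraMap _ (MvRat C σ) (MvPolynomial.pderiv i p))).snd = _
  rw [TrivSqZeroExt.snd_add, TrivSqZeroExt.snd_inl, TrivSqZeroExt.snd_inr, zero_add]

theorem taylorPoly_isUnit (i : σ) (p : nonZeroDivisors (MvPolynomial σ C)) :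
    IsUnit (taylorPoly (C := C) i p) := by
  rw [TrivSqZeroExt.isUnit_iff_isUnit_fst]
  rw [fst_taylorPoly]
  exact IsLocalization.map_units (MvRat C σ) p

/-- `f ↦ f + ε ∂f/∂x_i` on rational functions. -/
def taylor (i : σ) : MvRat C σ →+* TrivSqZeroExt (MvRat C σ) (MvRat C σ) :=
  IsLocalization.lift (M := nonZeroDivisors (MvPolynomial σ C)) (taylorPoly_isUnit i)

theorem taylor_algebraMap (i : σ) (p : MvPolynomial σ C) :
    taylor i (algebraMap _ (MvRat C σ) p) = taylorPoly i p :=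
  IsLocalization.lift_eq _ p

/-- The projection of the dual numbers to their base field. -/
def dualFst (K : Type*) [Field K] : TrivSqZeroExt K K →+* K where
  toFun := TrivSqZeroExt.fst
  map_one' := rfl
  map_zero' := rfl
  map_add' _ _ := rfl
  map_mul' _ _ := rfl

theorem fst_taylor (i : σ) (f : MvRat C σ) : (taylor i f).fst = f := by
  have h : (dualFst (MvRat C σ)).comp (taylor i) = RingHom.id _ := by
    apply IsLocalization.ringHom_ext (nonZeroDivisors (MvPolynomial σ C))
    refine RingHom.ext fun p => ?_
    change (taylor i (algebraMap _ (MvRat C σ) p)).fst = algebraMap _ (MvRat C σ) p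
    rw [taylor_algebraMap, fst_taylorPoly]
  exact congrArg (fun g : MvRat C σ →+* MvRat C σ => g f) h

theorem snd_taylor_mul (i : σ) (f g : MvRat C σ) :
    (taylor i (f * g)).snd = f * (taylor i g).snd + g * (taylor i f).snd := by
  rw [map_mul, TrivSqZeroExt.snd_mul, fst_taylor, fst_taylor, op_smul_eq_smul, smul_eq_mul,
    smul_eq_mul]

theorem smul_eq_algebraMap_mul (c : C) (f : MvRat C σ) :
    c • f = algebraMap (MvPolynomial σ C) (MvRat C σ) (MvPolynomial.C c) * f := by
  rw [Algebra.smul_def, IsScalarTower.algebraMap_apply C (MvPolynomial σ C) (MvRat C σ)]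
  rfl

/-- The partial derivative `∂/∂x_i` of rational functions. -/
def pderivRat (i : σ) : Derivation C (MvRat C σ) (MvRat C σ) :=
  Derivation.mk'
    { toFun := fun f => (taylor i f).snd
      map_add' := fun f g => by rw [map_add, TrivSqZeroExt.snd_add]
      map_smul' := fun c f => by
        rw [smul_eq_algebraMap_mul, snd_taylor_mul, taylor_algebraMap, snd_taylorPoly,
          MvPolynomial.pderiv_C, map_zero, mul_zero, add_zero, RingHom.id_apply,
          smul_eq_algebraMap_mul] }
    (fun f g => snd_taylor_mul i f g)

/-- On polynomials, `pderivRat` is the usual partial derivative. -/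
theorem pderivRat_algebraMap (i : σ) (p : MvPolynomial σ C) :
    pderivRat i (algebraMap _ (MvRat C σ) p)
      = algebraMap _ (MvRat C σ) (MvPolynomial.pderiv i p) := by
  change (taylor i (algebraMap _ (MvRat C σ) p)).snd = _
  rw [taylor_algebraMap, snd_taylorPoly]

/-- The partial derivative `∂/∂x_i` as an additive map. -/
def pderivAdd (i : σ) : MvRat C σ →+ MvRat C σ := (pderivRat i).toLinearMap.toAddMonoidHom

theorem pderivAdd_apply (i : σ) (f : MvRat C σ) : pderivAdd i f = pderivRat i f := rfl

theorem pderivAdd_mul (i : σ) (f g : MvRat C σ) :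
    pderivAdd i (f * g) = f * pderivAdd i g + g * pderivAdd i f :=
  snd_taylor_mul i f g

theorem pderivAdd_algebraMap (i : σ) (p : MvPolynomial σ C) :
    pderivAdd i (algebraMap _ (MvRat C σ) p)
      = algebraMap _ (MvRat C σ) (MvPolynomial.pderiv i p) :=
  pderivRat_algebraMap i p

end PartialDerivative

/-- Two derivations on a fraction field that agree on the base ring are equal. -/
theorem derivation_fraction_ext {A K L : Type*} [CommRing A] [IsDomain A] [Field K] [Algebra A K]
    [IsFractionRing A K] [Field L] (φ : K →+* L) (d₁ d₂ : K →+ L)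
    (h₁ : ∀ a b, d₁ (a * b) = φ a * d₁ b + φ b * d₁ a)
    (h₂ : ∀ a b, d₂ (a * b) = φ a * d₂ b + φ b * d₂ a)
    (h : ∀ a : A, d₁ (algebraMap A K a) = d₂ (algebraMap A K a)) (f : K) : d₁ f = d₂ f := by
  obtain ⟨a, b, hb, rfl⟩ := IsFractionRing.div_surjective (A := A) f
  have hb' : algebraMap A K b ≠ 0 :=
    IsFractionRing.to_map_ne_zero_of_mem_nonZeroDivisors hb
  have e : algebraMap A K b * (algebraMap A K a / algebraMap A K b) = algebraMap A K a := by
    field_simp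
  have e₁ := h₁ (algebraMap A K b) (algebraMap A K a / algebraMap A K b)
  have e₂ := h₂ (algebraMap A K b) (algebraMap A K a / algebraMap A K b)
  rw [e, h a, h b] at e₁
  rw [e, e₁] at e₂
  exact mul_left_cancel₀ (by simpa using hb') (add_right_cancel e₂)

theorem mvPolynomial_pderiv_comm {C σ : Type*} [Field C] (i j : σ) (p : MvPolynomial σ C) :
    MvPolynomial.pderiv i (MvPolynomial.pderiv j p)
      = MvPolynomial.pderiv j (MvPolynomial.pderiv i p) := by
  have : ⁅MvPolynomial.pderiv (R := C) i, MvPolynomial.pderiv (R := C) j⁆ = 0 := by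
    classical
    apply MvPolynomial.derivation_ext
    intro l
    simp only [Derivation.commutator_apply, MvPolynomial.pderiv_X, Derivation.coe_zero,
      Pi.zero_apply]
    by_cases h1 : l = i <;> by_cases h2 : l = j <;>
      simp [Pi.single_apply, h1, h2, apply_ite]
  have h := congrArg
    (fun D : Derivation C (MvPolynomial σ C) (MvPolynomial σ C) => D p) this
  simpa [Derivation.commutator_apply, sub_eq_zero] using h

/-- Partial derivatives of rational functions commute. -/
theorem pderivAdd_comm {C σ : Type*} [Field C] (i j : σ) (f : MvRat C σ) :
    pderivAdd i (pderivAdd j f) = pderivAdd j (pderivAdd i f) := by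
  -- the commutator is a derivation that vanishes on polynomials
  have := derivation_fraction_ext (A := MvPolynomial σ C) (RingHom.id (MvRat C σ))
    ((pderivAdd i).comp (pderivAdd j) - (pderivAdd j).comp (pderivAdd i)) 0 ?_ ?_ ?_ f
  · exact sub_eq_zero.mp this
  · intro a b
    simp only [AddMonoidHom.sub_apply, AddMonoidHom.comp_apply, pderivAdd_mul, map_add,
      RingHom.id_apply]
    ring
  · intro a b; simp
  · intro p
    simp only [AddMonoidHom.sub_apply, AddMonoidHom.comp_apply, pderivAdd_algebraMap,
      mvPolynomial_pderiv_comm i j p, sub_self, AddMonoidHom.zero_apply]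

/-! ### Differential Ore algebras -/

/-- A family of pairwise commuting derivations of the ring `K`. -/
structure CommDer (K σ : Type*) [CommRing K] where
  /-- the derivations -/
  d : σ → K →+ K
  /-- the Leibniz rule -/
  leibniz : ∀ i a b, d i (a * b) = a * d i b + d i a * b
  /-- the derivations commute pairwise -/
  comm : ∀ i j a, d i (d j a) = d j (d i a)

/-- The partial derivatives of the field of rational functions `C(x_i : i ∈ σ)`. -/
def partials (C σ : Type*) [Field C] : CommDer (MvRat C σ) σ where
  d i := pderivAdd i
  leibniz i a b := by rw [pderivAdd_mul, mul_comm b]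
  comm i j a := pderivAdd_comm i j a

/-- The Ore algebra `K⟨∂_i : i ∈ σ⟩` with `∂_i a = a ∂_i + δ_i(a)` and `∂_i ∂_j = ∂_j ∂_i`:
its elements are the finite sums `∑ c_α ∂^α`, and `∂^α` is encoded by the exponent `α`.
The product is constructed below. -/
def Ore {K σ : Type*} [CommRing K] (_Δ : CommDer K σ) : Type _ := (σ →₀ ℕ) →₀ K

namespace Ore

section Basic

variable {K σ : Type*} [CommRing K] {Δ : CommDer K σ}

instance : AddCommGroup (Ore Δ) := inferInstanceAs (AddCommGroup ((σ →₀ ℕ) →₀ K))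

instance : Module K (Ore Δ) := inferInstanceAs (Module K ((σ →₀ ℕ) →₀ K))

/-- The finitely supported family of the coefficients `c_α` of `∑ c_α ∂^α`. -/
def coeffs : Ore Δ ≃ₗ[K] ((σ →₀ ℕ) →₀ K) := LinearEquiv.refl K _

/-- The operator `a ∂^α`. -/
def term (α : σ →₀ ℕ) (a : K) : Ore Δ := coeffs.symm (Finsupp.single α a)

theorem term_zero (α : σ →₀ ℕ) : (term α 0 : Ore Δ) = 0 := Finsupp.single_zero α

theorem term_add (α : σ →₀ ℕ) (a b : K) : (term α (a + b) : Ore Δ) = term α a + term α b :=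
  Finsupp.single_add α a b

theorem smul_term (c : K) (α : σ →₀ ℕ) (a : K) : c • (term α a : Ore Δ) = term α (c * a) :=
  Finsupp.smul_single c α a

/-- Additive maps out of the Ore algebra, given on the operators `a ∂^α`. -/
def lift {M : Type*} [AddCommMonoid M] (u : (σ →₀ ℕ) → K →+ M) : Ore Δ →+ M :=
  (Finsupp.liftAddHom u : ((σ →₀ ℕ) →₀ K) →+ M)

@[simp] theorem lift_term {M : Type*} [AddCommMonoid M] (u : (σ →₀ ℕ) → K →+ M)
    (α : σ →₀ ℕ) (a : K) : lift u (term α a : Ore Δ) = u α a :=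
  Finsupp.liftAddHom_apply_single u α a

theorem induction {P : Ore Δ → Prop} (f : Ore Δ) (zero : P 0)
    (add : ∀ f g, P f → P g → P (f + g)) (term : ∀ α a, P (term α a)) : P f :=
  Finsupp.induction_linear f zero add term

/-- `a ↦ a ∂^α` as an additive map. -/
def termHom (α : σ →₀ ℕ) : K →+ Ore Δ where
  toFun := term α
  map_zero' := term_zero α
  map_add' := term_add α

theorem termHom_apply (α : σ →₀ ℕ) (a : K) : (termHom α a : Ore Δ) = term α a := rfl

/-- Left multiplication by `∂_i`:  `∂_i · (a ∂^α) = a ∂^(α + e_i) + δ_i(a) ∂^α`. -/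
def dmul (i : σ) : Module.End ℤ (Ore Δ) :=
  (lift fun α => termHom (α + Finsupp.single i 1) + (termHom α).comp (Δ.d i)).toIntLinearMap

theorem dmul_term (i : σ) (α : σ →₀ ℕ) (a : K) :
    dmul i (term α a : Ore Δ) = term (α + Finsupp.single i 1) a + term α (Δ.d i a) :=
  lift_term _ α a

theorem dmul_smul (i : σ) (a : K) (f : Ore Δ) :
    dmul i (a • f) = a • dmul i f + Δ.d i a • f := by
  induction f using Ore.induction with
  | zero => simp
  | add f g hf hg =>
    rw [smul_add, map_add, hf, hg, map_add, smul_add, smul_add]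
    abel
  | term α b =>
    rw [smul_term, dmul_term, dmul_term, smul_add, smul_term, smul_term, smul_term, Δ.leibniz,
      term_add, add_assoc]

theorem dmul_comm (i j : σ) : Commute (dmul i : Module.End ℤ (Ore Δ)) (dmul j) := by
  refine LinearMap.ext fun f => ?_
  rw [Module.End.mul_apply, Module.End.mul_apply]
  induction f using Ore.induction with
  | zero => simp
  | add f g hf hg => simp only [map_add, hf, hg]
  | term α a =>
    simp only [dmul_term, map_add, Δ.comm i j a]
    rw [add_right_comm α]
    abel

theorem dmul_pow_comm (α β : σ → ℕ) (s : Set σ) : s.Pairwise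
    fun i j => Commute (dmul i ^ α i : Module.End ℤ (Ore Δ)) (dmul j ^ β j) :=
  fun i _ j _ _ => (dmul_comm i j).pow_pow _ _

/-- Induction on exponents. -/
theorem exp_induction {σ : Type*} {P : (σ →₀ ℕ) → Prop} (α : σ →₀ ℕ) (zero : P 0)
    (single_add : ∀ i α, P α → P (Finsupp.single i 1 + α)) : P α := by
  have hs : ∀ i n α, P α → P (Finsupp.single i n + α) := by
    intro i n
    induction n with
    | zero => intro α h; simpa using h
    | succ n ih =>
      intro α h
      have := single_add i _ (ih α h)
      rwa [← add_assoc, ← Finsupp.single_add, add_comm 1 n] at this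
  induction α using Finsupp.induction with
  | zero => exact zero
  | single_add i n α _ _ h => exact hs i n α h

end Basic

section Mul

variable {K σ : Type*} [CommRing K] [Fintype σ] {Δ : CommDer K σ}

/-- Left multiplication by `∂^α`: the composition of the `α i`-th iterates of `dmul i`. -/
def dpow (α : σ →₀ ℕ) : Module.End ℤ (Ore Δ) :=
  Finset.univ.noncommProd (fun i => dmul i ^ α i) (dmul_pow_comm α α _)

theorem dpow_zero : (dpow 0 : Module.End ℤ (Ore Δ)) = 1 := by
  refine (Finset.noncommProd_eq_pow_card _ _ _ 1 ?_).trans (one_pow _)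
  intro i _
  exact pow_zero _

theorem dpow_add (α β : σ →₀ ℕ) :
    (dpow (α + β) : Module.End ℤ (Ore Δ)) = dpow α * dpow β := by
  refine Eq.trans ?_ (Finset.noncommProd_mul_distrib (s := Finset.univ)
    (fun i => (dmul i : Module.End ℤ (Ore Δ)) ^ α i) (fun i => dmul i ^ β i)
    (dmul_pow_comm α α _) (dmul_pow_comm β β _) (dmul_pow_comm β α _))
  refine Finset.noncommProd_congr rfl ?_ _
  intro i _
  exact pow_add _ _ _

theorem dpow_single (i : σ) :
    (dpow (Finsupp.single i 1) : Module.End ℤ (Ore Δ)) = dmul i := by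
  classical
  refine (Finset.mul_noncommProd_erase Finset.univ (Finset.mem_univ i)
    (fun j => (dmul j : Module.End ℤ (Ore Δ)) ^ Finsupp.single i 1 j)
    (dmul_pow_comm _ _ _)).symm.trans ?_
  refine (congrArg₂ (x' := dmul i) (· * ·) ?_
    (Finset.noncommProd_eq_pow_card _ _ _ 1 ?_)).trans ?_
  · rw [Finsupp.single_eq_same, pow_one]
  · intro j hj
    rw [Finsupp.single_eq_of_ne (Finset.ne_of_mem_erase hj), pow_zero]
  · rw [one_pow, mul_one]

theorem dpow_single_add (i : σ) (α : σ →₀ ℕ) (f : Ore Δ) :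
    dpow (Finsupp.single i 1 + α) f = dmul i (dpow α f) := by
  rw [dpow_add, dpow_single, Module.End.mul_apply]

theorem dpow_term_one (α β : σ →₀ ℕ) : dpow α (term β 1 : Ore Δ) = term (α + β) 1 := by
  have d1 : ∀ i, Δ.d i 1 = 0 := by
    intro i
    have := Δ.leibniz i 1 1
    simpa using this
  induction α using exp_induction with
  | zero => simp [dpow_zero]
  | single_add i α h =>
    rw [dpow_single_add, h, dmul_term, d1, term_zero, add_zero]
    congr 1
    abel

/-- Left multiplication in the Ore algebra: `(∑ c_α ∂^α) · g = ∑ c_α (∂^α · g)`. -/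
def mulHom : Ore Δ →+ Ore Δ →+ Ore Δ :=
  lift fun α =>
    { toFun := fun a => (DistribSMul.toAddMonoidHom (Ore Δ) a).comp (dpow α).toAddMonoidHom
      map_zero' := AddMonoidHom.ext fun _ => zero_smul K _
      map_add' := fun a b => AddMonoidHom.ext fun _ => add_smul a b _ }

theorem mulHom_term (α : σ →₀ ℕ) (a : K) (g : Ore Δ) :
    mulHom (term α a) g = a • dpow α g :=
  DFunLike.congr_fun (lift_term _ α a) g

instance : Mul (Ore Δ) := ⟨fun f g => mulHom f g⟩

instance : One (Ore Δ) := ⟨term 0 1⟩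

theorem one_def : (1 : Ore Δ) = term 0 1 := rfl

theorem mul_def (f g : Ore Δ) : f * g = mulHom f g := rfl

theorem term_mul (α : σ →₀ ℕ) (a : K) (g : Ore Δ) : term α a * g = a • dpow α g :=
  mulHom_term α a g

instance : NonUnitalNonAssocRing (Ore Δ) :=
  { (inferInstance : AddCommGroup (Ore Δ)), (inferInstance : Mul (Ore Δ)) with
    left_distrib := fun f g h => map_add (mulHom f) g h
    right_distrib := fun f g h => by simp only [mul_def, map_add, AddMonoidHom.add_apply]
    zero_mul := fun f => by simp only [mul_def, map_zero, AddMonoidHom.zero_apply]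
    mul_zero := fun f => by simp only [mul_def, map_zero] }

theorem smul_mul (a : K) (f g : Ore Δ) : (a • f) * g = a • (f * g) := by
  induction f using Ore.induction with
  | zero => simp
  | add f₁ f₂ h₁ h₂ => simp only [smul_add, add_mul, h₁, h₂]
  | term α b => rw [smul_term, term_mul, term_mul, mul_smul]

theorem dmul_mul (i : σ) (f g : Ore Δ) : (dmul i f) * g = dmul i (f * g) := by
  induction f using Ore.induction with
  | zero => simp
  | add f₁ f₂ h₁ h₂ => simp only [map_add, add_mul, h₁, h₂]
  | term α b =>
    rw [dmul_term, add_mul, term_mul, term_mul, term_mul, dmul_smul, add_comm α, dpow_single_add]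

theorem dpow_mul (α : σ →₀ ℕ) (f g : Ore Δ) : (dpow α f) * g = dpow α (f * g) := by
  induction α using exp_induction with
  | zero => simp [dpow_zero]
  | single_add i α h => rw [dpow_single_add, dpow_single_add, dmul_mul, h]

/-- The ring structure of the Ore algebra. -/
instance : Ring (Ore Δ) :=
  { (inferInstance : NonUnitalNonAssocRing (Ore Δ)), (inferInstance : AddCommGroup (Ore Δ)),
    (inferInstance : One (Ore Δ)) with
    one_mul := fun f => by rw [one_def, term_mul, dpow_zero, one_smul, Module.End.one_apply]
    mul_one := fun f => by
      induction f using Ore.induction with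
      | zero => exact zero_mul _
      | add f₁ f₂ h₁ h₂ => rw [add_mul, h₁, h₂]
      | term α b => rw [term_mul, one_def, dpow_term_one, smul_term, mul_one, add_zero]
    mul_assoc := fun f g h => by
      induction f using Ore.induction with
      | zero => simp only [zero_mul]
      | add f₁ f₂ h₁ h₂ => simp only [add_mul, h₁, h₂]
      | term α b => rw [term_mul, term_mul, smul_mul, dpow_mul] }

instance : IsScalarTower K (Ore Δ) (Ore Δ) := ⟨smul_mul⟩

/-- The element `a ∈ K` of the Ore algebra. -/
def const (a : K) : Ore Δ := term 0 a

/-- The generator `∂_i`. -/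
def gen (i : σ) : Ore Δ := term (Finsupp.single i 1) 1

theorem gen_mul (i : σ) (f : Ore Δ) : gen i * f = dmul i f := by
  rw [gen, term_mul, dpow_single, one_smul]

theorem const_mul (a : K) (f : Ore Δ) : const a * f = a • f := by
  rw [const, term_mul, dpow_zero, Module.End.one_apply]

/-- The defining relation `∂_i a = a ∂_i + δ_i(a)`. -/
theorem gen_mul_const (i : σ) (a : K) :
    (gen i * const a : Ore Δ) = const a * gen i + const (Δ.d i a) := by
  rw [gen_mul, const_mul, const, dmul_term, gen, smul_term, zero_add, mul_one]
  rfl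

/-- The defining relation `∂_i ∂_j = ∂_j ∂_i`. -/
theorem gen_mul_gen (i j : σ) : (gen i * gen j : Ore Δ) = gen j * gen i := by
  simp only [gen, term_mul, dpow_term_one, one_smul, add_comm]

end Mul

section Map

variable {K L σ τ : Type*} [CommRing K] [CommRing L] [Fintype σ] [Fintype τ]
  {Δ : CommDer K σ} {Δ' : CommDer L τ}

/-- The additive map `∑ c_α ∂^α ↦ ∑ φ(c_α) ∂^(e α)`, where `∂_i` goes to `∂_(e i)`. -/
def mapAdd (Δ : CommDer K σ) (Δ' : CommDer L τ) (φ : K →+* L) (e : σ → τ) : Ore Δ →+ Ore Δ' :=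
  lift fun α => (termHom (α.mapDomain e)).comp φ.toAddMonoidHom

theorem mapAdd_term (φ : K →+* L) (e : σ → τ) (α : σ →₀ ℕ) (a : K) :
    mapAdd Δ Δ' φ e (term α a) = term (α.mapDomain e) (φ a) :=
  lift_term _ α a

theorem mapAdd_smul (φ : K →+* L) (e : σ → τ) (a : K) (f : Ore Δ) :
    mapAdd Δ Δ' φ e (a • f) = φ a • mapAdd Δ Δ' φ e f := by
  induction f using Ore.induction with
  | zero => simp
  | add f g hf hg => simp only [smul_add, map_add, hf, hg]
  | term α b => rw [smul_term, mapAdd_term, mapAdd_term, smul_term, map_mul]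

theorem mapAdd_dmul (φ : K →+* L) (e : σ → τ) (h : ∀ i a, φ (Δ.d i a) = Δ'.d (e i) (φ a))
    (i : σ) (f : Ore Δ) : mapAdd Δ Δ' φ e (dmul i f) = dmul (e i) (mapAdd Δ Δ' φ e f) := by
  induction f using Ore.induction with
  | zero => simp
  | add f g hf hg => simp only [map_add, hf, hg]
  | term α b =>
    rw [dmul_term, map_add, mapAdd_term, mapAdd_term, mapAdd_term, dmul_term, h,
      Finsupp.mapDomain_add, Finsupp.mapDomain_single]

theorem mapAdd_dpow (φ : K →+* L) (e : σ → τ) (h : ∀ i a, φ (Δ.d i a) = Δ'.d (e i) (φ a))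
    (α : σ →₀ ℕ) (f : Ore Δ) :
    mapAdd Δ Δ' φ e (dpow α f) = dpow (α.mapDomain e) (mapAdd Δ Δ' φ e f) := by
  induction α using exp_induction with
  | zero => simp [dpow_zero]
  | single_add i α ih =>
    rw [Finsupp.mapDomain_add, Finsupp.mapDomain_single, dpow_single_add, dpow_single_add,
      mapAdd_dmul φ e h, ih]

theorem mapAdd_mul (φ : K →+* L) (e : σ → τ) (h : ∀ i a, φ (Δ.d i a) = Δ'.d (e i) (φ a))
    (f g : Ore Δ) :
    mapAdd Δ Δ' φ e (f * g) = mapAdd Δ Δ' φ e f * mapAdd Δ Δ' φ e g := by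
  induction f using Ore.induction with
  | zero => simp
  | add f₁ f₂ h₁ h₂ => simp only [add_mul, map_add, h₁, h₂]
  | term α a => rw [term_mul, mapAdd_term, term_mul, mapAdd_smul, mapAdd_dpow φ e h]

/-- The ring homomorphism of Ore algebras that is `φ` on coefficients and `∂_i ↦ ∂_(e i)`. -/
def mapHom (φ : K →+* L) (e : σ → τ) (h : ∀ i a, φ (Δ.d i a) = Δ'.d (e i) (φ a)) :
    Ore Δ →+* Ore Δ' where
  toFun := mapAdd Δ Δ' φ e
  map_one' := by
    rw [one_def, mapAdd_term, map_one, Finsupp.mapDomain_zero]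
    rfl
  map_mul' := mapAdd_mul φ e h
  map_zero' := map_zero _
  map_add' := map_add _

theorem mapHom_term (φ : K →+* L) (e : σ → τ) (h : ∀ i a, φ (Δ.d i a) = Δ'.d (e i) (φ a))
    (α : σ →₀ ℕ) (a : K) : mapHom φ e h (term α a : Ore Δ) = term (α.mapDomain e) (φ a) :=
  mapAdd_term φ e α a

/-- `∂_j` commutes with the image of `mapHom` if `δ_j` kills the image of `φ`. -/
theorem gen_mul_mapHom (φ : K →+* L) (e : σ → τ) (h : ∀ i a, φ (Δ.d i a) = Δ'.d (e i) (φ a))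
    (j : τ) (hj : ∀ a, Δ'.d j (φ a) = 0) (f : Ore Δ) :
    gen j * mapHom φ e h f = mapHom φ e h f * gen j := by
  induction f using Ore.induction with
  | zero => simp only [map_zero, mul_zero, zero_mul]
  | add f₁ f₂ h₁ h₂ => simp only [map_add, mul_add, add_mul, h₁, h₂]
  | term α a =>
    rw [mapHom_term, gen_mul, dmul_term, hj, term_zero, add_zero, term_mul, gen, dpow_term_one,
      smul_term, mul_one]

end Map

/-! ### Hilbert dimension -/

section Hilbert

variable {K σ : Type*} [Field K] [Fintype σ] {Δ : CommDer K σ}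

/-- The `K`-space of the operators of total degree at most `s`. -/
def degLE (Δ : CommDer K σ) (s : ℕ) : Submodule K (Ore Δ) :=
  (Finsupp.supported K K {α : σ →₀ ℕ | α.degree ≤ s}).comap (coeffs (Δ := Δ)).toLinearMap

/-- The Hilbert function `s ↦ dim_K (R^(s) / (I ∩ R^(s)))` of a left ideal `I`. -/
def hilbertFunction (I : Ideal (Ore Δ)) (s : ℕ) : ℕ :=
  Module.finrank K
    (degLE Δ s ⧸ (Submodule.restrictScalars K I).comap (degLE Δ s).subtype)

/-- The left ideal `I` has (Hilbert) dimension `d`: for `s` large enough its Hilbert function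
agrees with a polynomial of degree `d`. The zero polynomial (which occurs only for the unit ideal)
is given the degree `0`. -/
def HasHilbertDim (I : Ideal (Ore Δ)) (d : ℕ) : Prop :=
  ∃ p : Polynomial ℚ, p.natDegree = d ∧ ∀ᶠ s : ℕ in Filter.atTop, (hilbertFunction I s : ℚ) = p.eval (s : ℚ)

end Hilbert

/-! ### Gröbner bases and normal forms -/

section Groebner

variable {K σ : Type*} [Field K] [Fintype σ] {Δ : CommDer K σ}

/-- `α` is the exponent of the leading term of `f` (in particular `f ≠ 0`). -/
def IsLeadingExp (ord : MonomialOrder σ) (f : Ore Δ) (α : σ →₀ ℕ) : Prop :=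
  α ∈ (coeffs f).support ∧ ∀ β ∈ (coeffs f).support, ord.toSyn β ≤ ord.toSyn α

/-- `G` is a Gröbner basis of the left ideal `I`: it generates `I`, and the exponents of the
leading terms of elements of `I` are the multiples of those of elements of `G`. -/
def IsGroebnerBasis (ord : MonomialOrder σ) (G : Set (Ore Δ)) (I : Ideal (Ore Δ)) : Prop :=
  Ideal.span G = I ∧
    {α | ∃ f ∈ I, IsLeadingExp ord f α} = {α | ∃ g ∈ G, ∃ β, IsLeadingExp ord g β ∧ β ≤ α}

/-- `r` is the normal form of `f` with respect to the Gröbner basis `G`: it is congruent to `f`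
modulo the left ideal generated by `G`, and no monomial of `r` is a multiple of the leading
monomial of an element of `G`. -/
def IsNormalForm (ord : MonomialOrder σ) (G : Set (Ore Δ)) (f r : Ore Δ) : Prop :=
  f - r ∈ Ideal.span G ∧
    ∀ α ∈ (coeffs r).support, ∀ g ∈ G, ∀ β, IsLeadingExp ord g β → ¬ β ≤ α

/-- The monomial order compares total degrees first. -/
def IsGraded (ord : MonomialOrder σ) : Prop :=
  ∀ α β : σ →₀ ℕ, α.degree < β.degree → ord.toSyn α < ord.toSyn β

end Groebner

end Ore

/-! ### The differential Ore algebra `C(x,t)⟨∂_x, ∂_t⟩` -/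

section Telescoping

universe u v w

variable (C : Type w) (ξ : Type u) (τ : Type v) [Field C]

/-- The differential Ore algebra `C(x_i : i ∈ σ)⟨∂_i : i ∈ σ⟩`. -/
abbrev DOre (C σ : Type*) [Field C] : Type _ := Ore (partials C σ)

/-- The inclusion `C(x) → C(x,t)`; the variables `x` are indexed by `ξ` and `t` by `τ`. -/
def inclX : MvRat C ξ →+* MvRat C (ξ ⊕ τ) :=
  IsFractionRing.map (j := (MvPolynomial.rename (R := C) (Sum.inl : ξ → ξ ⊕ τ)).toRingHom)
    (MvPolynomial.rename_injective _ Sum.inl_injective)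

variable {ξ τ}

theorem inclX_algebraMap (p : MvPolynomial ξ C) :
    inclX C ξ τ (algebraMap _ (MvRat C ξ) p)
      = algebraMap (MvPolynomial (ξ ⊕ τ) C) (MvRat C (ξ ⊕ τ)) (MvPolynomial.rename Sum.inl p) :=
  IsLocalization.map_eq (M := nonZeroDivisors (MvPolynomial ξ C))
    (T := nonZeroDivisors (MvPolynomial (ξ ⊕ τ) C))
    (nonZeroDivisors_le_comap_nonZeroDivisors_of_injective _
      (MvPolynomial.rename_injective _ Sum.inl_injective)) p

theorem inclX_pderivAdd (i : ξ) (a : MvRat C ξ) :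
    inclX C ξ τ (pderivAdd i a) = pderivAdd (Sum.inl i) (inclX C ξ τ a) := by
  refine derivation_fraction_ext (A := MvPolynomial ξ C) (inclX C ξ τ)
    ((inclX C ξ τ).toAddMonoidHom.comp (pderivAdd i))
    ((pderivAdd (Sum.inl i)).comp (inclX C ξ τ).toAddMonoidHom) ?_ ?_ ?_ a
  · intro a b
    change inclX C ξ τ (pderivAdd i (a * b)) = _
    rw [pderivAdd_mul, map_add, map_mul, map_mul]
    rfl
  · intro a b
    change pderivAdd (Sum.inl i) (inclX C ξ τ (a * b)) = _
    rw [map_mul, pderivAdd_mul]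
    rfl
  · intro p
    change inclX C ξ τ (pderivAdd i (algebraMap _ _ p))
      = pderivAdd (Sum.inl i) (inclX C ξ τ (algebraMap _ _ p))
    rw [pderivAdd_algebraMap, inclX_algebraMap, inclX_algebraMap, pderivAdd_algebraMap,
      MvPolynomial.pderiv_rename Sum.inl_injective]

theorem pderivAdd_inclX (j : τ) (a : MvRat C ξ) :
    pderivAdd (Sum.inr j) (inclX C ξ τ a) = 0 := by
  refine derivation_fraction_ext (A := MvPolynomial ξ C) (inclX C ξ τ)
    ((pderivAdd (Sum.inr j)).comp (inclX C ξ τ).toAddMonoidHom) 0 ?_ ?_ ?_ a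
  · intro a b
    change pderivAdd (Sum.inr j) (inclX C ξ τ (a * b)) = _
    rw [map_mul, pderivAdd_mul]
    rfl
  · intro a b; simp
  · intro p
    change pderivAdd (Sum.inr j) (inclX C ξ τ (algebraMap _ _ p)) = 0
    rw [inclX_algebraMap, pderivAdd_algebraMap, MvPolynomial.pderiv_eq_zero_of_notMem_vars,
      map_zero]
    intro h
    obtain ⟨_, _, h⟩ := MvPolynomial.mem_vars_rename _ _ h
    exact Sum.inl_ne_inr h

/-- The evaluation `C(x)[t] → C(x,t)`; its image is the subring `C(x)[t]` of `C(x,t)`. -/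
def polyT : MvPolynomial τ (MvRat C ξ) →+* MvRat C (ξ ⊕ τ) :=
  MvPolynomial.eval₂Hom (inclX C ξ τ)
    (fun j => algebraMap (MvPolynomial (ξ ⊕ τ) C) _ (MvPolynomial.X (Sum.inr j)))

/-- `c` lies in `C(x)[t]` and has degree at most `n` with respect to `t`. -/
def IsPolyT (n : ℕ) (c : MvRat C (ξ ⊕ τ)) : Prop :=
  ∃ q : MvPolynomial τ (MvRat C ξ), q.totalDegree ≤ n ∧ polyT C q = c

variable {C} [Fintype ξ] [Fintype τ]

/-- The inclusion of `C(x)⟨∂_x⟩` into `C(x,t)⟨∂_x, ∂_t⟩`. -/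
def inclOre : DOre C ξ →+* DOre C (ξ ⊕ τ) :=
  Ore.mapHom (inclX C ξ τ) Sum.inl (inclX_pderivAdd C)

/-- The additive subgroup `I + ∑_j ∂_{t_j} C(x,t)⟨∂_x, ∂_t⟩`. -/
def telescopingSum (I : Ideal (DOre C (ξ ⊕ τ))) : AddSubgroup (DOre C (ξ ⊕ τ)) :=
  I.toAddSubgroup ⊔ ⨆ j : τ, (AddMonoidHom.mulLeft (Ore.gen (Sum.inr j : ξ ⊕ τ))).range

theorem mul_mem_telescopingSum (I : Ideal (DOre C (ξ ⊕ τ))) (f : DOre C ξ) :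
    telescopingSum I ≤ (telescopingSum I).comap (AddMonoidHom.mulLeft (inclOre f)) := by
  refine sup_le ?_ (iSup_le fun j => ?_)
  · intro g hg
    exact AddSubgroup.mem_sup_left (I.mul_mem_left (inclOre f) hg)
  · rintro _ ⟨g, rfl⟩
    refine AddSubgroup.mem_sup_right (AddSubgroup.mem_iSup_of_mem j ⟨inclOre f * g, ?_⟩)
    change Ore.gen _ * (inclOre f * g) = inclOre f * (Ore.gen _ * g)
    rw [← mul_assoc, ← mul_assoc]
    congr 1
    exact Ore.gen_mul_mapHom _ _ _ _ (pderivAdd_inclX C j) f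

/-- The telescoping `T_t(I) = (I + ∑_j ∂_{t_j} C(x,t)⟨∂_x, ∂_t⟩) ∩ C(x)⟨∂_x⟩`,
a left ideal of `C(x)⟨∂_x⟩`. -/
def telescoping (I : Ideal (DOre C (ξ ⊕ τ))) : Ideal (DOre C ξ) where
  carrier := {f | inclOre f ∈ telescopingSum I}
  add_mem' {f g} hf hg := by
    rw [Set.mem_ofPred_eq, map_add]
    exact add_mem hf hg
  zero_mem' := by
    rw [Set.mem_ofPred_eq, map_zero]
    exact zero_mem _
  smul_mem' f g hg := by
    rw [Set.mem_ofPred_eq, smul_eq_mul, map_mul]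
    exact mul_mem_telescopingSum I f hg

/-! ### Polynomial growth -/

/-- Polynomial growth `p` of a left ideal `I` of `C(x,t)⟨∂_x, ∂_t⟩` with respect to a monomial
order: there are nonzero polynomials `P_s ∈ C[x,t]` such that for `|α| ≤ s` the normal form of
`P_s ∂^α` with respect to a Gröbner basis of `I` has coefficients in `C(x)[t]` of degree `O(s^p)`
with respect to `t`, uniformly in `α`. -/
def HasPolynomialGrowthWrt (ord : MonomialOrder (ξ ⊕ τ)) (I : Ideal (DOre C (ξ ⊕ τ)))
    (p : ℕ) : Prop :=
  ∃ G : Set (DOre C (ξ ⊕ τ)), Ore.IsGroebnerBasis ord G I ∧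
    ∃ (P : ℕ → MvPolynomial (ξ ⊕ τ) C) (D : ℕ → ℕ),
      (∀ s, P s ≠ 0) ∧
      (fun s => (D s : ℝ)) =O[Filter.atTop] (fun s : ℕ => (s : ℝ) ^ p) ∧
      ∀ (s : ℕ) (α : ξ ⊕ τ →₀ ℕ), α.degree ≤ s →
        ∃ r : DOre C (ξ ⊕ τ),
          Ore.IsNormalForm ord G (Ore.term α (algebraMap _ _ (P s))) r ∧
          ∀ γ, IsPolyT C (D s) (Ore.coeffs r γ)

/-- A left ideal has polynomial growth `p` if it does with respect to some graded order. -/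
def HasPolynomialGrowth (I : Ideal (DOre C (ξ ⊕ τ))) (p : ℕ) : Prop :=
  ∃ ord : MonomialOrder.{max u v, max u v} (ξ ⊕ τ), Ore.IsGraded ord ∧ HasPolynomialGrowthWrt ord I p

end Telescoping

end DiffOreGrowth

end

/-! Dimension 0 means that the quotient by `I` is a finite-dimensional vector space over the
coefficient field: the images of the operators of degree at most `s` increase with `s`, exhaust the
quotient, and have eventually constant dimension. The finitely many standard monomials of any
monomial order then span it.

Growth 1 (`exists_linear_growth`). Let `q` be a common denominator for the coordinates of 1 and of
all products of a generator with a standard monomial. Applying one more generator to an already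
reduced monomial costs one factor `q` and raises the degrees of the numerators by a constant. Hence
`q^(s+1)` clears the denominators of every monomial of degree at most `s`, and the numerators have
degree O(s).

Telescoping. Fix one variable `x_i`. By counting (`exists_operator_free_of_t`), the `n^(k+1)`
monomials in `∂_i` and the `k` derivations `∂_t` with exponents below `n` have, after clearing
denominators, coordinate vectors in a `C(x)`-space of dimension O(n^k). For large `n` they are
dependent, so `I` contains a nonzero operator in `∂_i` and `∂_t` with coefficients in `C(x)`.

To remove `∂_t` without losing the operator, take an exponent `β₀` of `∂_t` that is minimal among
those occurring and multiply on the left by `t^β₀`. Integration by parts turns `t^β₀ ∂_t^β₀` into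
the nonzero constant `±β₀!`, and puts `t^β₀ ∂_t^β` in the sum of the `∂_t`-multiples for all other
`β` that occur (`exists_isLeadingExp_telescoping`). What remains is a nonzero operator in `∂_i`
alone, lying in the telescoping ideal. One such operator for each `i` bounds all exponents of
standard monomials of that ideal, so its quotient is finite-dimensional as well. -/

namespace DiffOreGrowth

namespace Ore

/-! ### Dimension 0 and finite-dimensional quotients -/

section Finiteness

variable {K σ : Type*} [Field K] [Fintype σ] {Δ : CommDer K σ}

/-- The Hilbert function is the dimension of the image of the operators of degree at most `s` in
the quotient by `I`. -/
theorem hilbertFunction_eq_finrank_map (I : Ideal (Ore Δ)) (s : ℕ) :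
    hilbertFunction I s
      = Module.finrank K ((degLE Δ s).map (Submodule.restrictScalars K I).mkQ) := by
  have e := LinearMap.quotKerEquivRange
    ((Submodule.restrictScalars K I).mkQ.comp (degLE Δ s).subtype)
  rw [LinearMap.ker_comp, Submodule.ker_mkQ, LinearMap.range_comp, Submodule.range_subtype] at e
  exact e.finrank_eq

theorem mem_degLE {s : ℕ} {f : Ore Δ} :
    f ∈ degLE Δ s ↔ ∀ α ∈ (coeffs f).support, α.degree ≤ s := by
  change coeffs f ∈ Finsupp.supported K K {α : σ →₀ ℕ | α.degree ≤ s} ↔ _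
  rw [Finsupp.mem_supported]
  rfl

instance degLE_finite (s : ℕ) : Module.Finite K (degLE Δ s) := by
  have : Finite {α : σ →₀ ℕ | α.degree ≤ s} := Finsupp.finite_of_degree_le s
  have : Module.Finite K (Finsupp.supported K K {α : σ →₀ ℕ | α.degree ≤ s}) :=
    Module.Finite.equiv (Finsupp.supportedEquivFinsupp _).symm
  exact Module.Finite.equiv ((coeffs (Δ := Δ)).submoduleMap (degLE Δ s) |>.trans
    (LinearEquiv.ofEq _ _ (Submodule.map_comap_eq_of_surjective coeffs.surjective _))).symm

theorem degLE_mono : Monotone (degLE Δ) := fun _ _ h _ hf =>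
  mem_degLE.2 fun α hα => (mem_degLE.1 hf α hα).trans h

theorem exists_mem_degLE (f : Ore Δ) : ∃ s, f ∈ degLE Δ s :=
  ⟨(coeffs f).support.sup Finsupp.degree, mem_degLE.2 fun _ hα => Finset.le_sup hα⟩

/-- The images of the `degLE Δ s` form an increasing chain whose union is the quotient. From `s₀` on
their dimensions agree, so the chain is constant and its term at `s₀` is already everything. -/
theorem finite_of_hasHilbertDim_zero {I : Ideal (Ore Δ)} (h : HasHilbertDim I 0) :
    Module.Finite K (Ore Δ ⧸ Submodule.restrictScalars K I) := by
  obtain ⟨p, hp, hs⟩ := h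
  obtain ⟨s₀, hs₀⟩ := Filter.eventually_atTop.1 hs
  rw [Polynomial.eq_C_of_natDegree_eq_zero hp] at hs₀
  simp only [Polynomial.eval_C] at hs₀
  have key : ∀ s, s₀ ≤ s → (degLE Δ s₀).map (Submodule.restrictScalars K I).mkQ
      = (degLE Δ s).map (Submodule.restrictScalars K I).mkQ := fun s h => by
    refine Submodule.eq_of_le_of_finrank_eq (Submodule.map_mono (degLE_mono h)) ?_
    rw [← hilbertFunction_eq_finrank_map, ← hilbertFunction_eq_finrank_map]
    exact_mod_cast (hs₀ s₀ le_rfl).trans (hs₀ s h).symm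
  have top : (degLE Δ s₀).map (Submodule.restrictScalars K I).mkQ = ⊤ := by
    refine eq_top_iff.2 fun x _ => ?_
    obtain ⟨f, rfl⟩ := Submodule.mkQ_surjective _ x
    obtain ⟨s, hf⟩ := exists_mem_degLE f
    rw [key _ (le_max_left s₀ s)]
    exact Submodule.mem_map_of_mem (degLE_mono (le_max_right s₀ s) hf)
  exact ⟨top ▸ (Module.Finite.iff_fg.1 (degLE_finite (Δ := Δ) s₀)).map _⟩

/-- In a finite-dimensional quotient the same increasing chain stabilizes, so the Hilbert function
is eventually constant. -/
theorem hasHilbertDim_zero_of_finite {I : Ideal (Ore Δ)}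
    (h : Module.Finite K (Ore Δ ⧸ Submodule.restrictScalars K I)) : HasHilbertDim I 0 := by
  obtain ⟨s₀, hs₀⟩ := monotone_stabilizes_iff_noetherian.2
    (inferInstance : IsNoetherian K (Ore Δ ⧸ Submodule.restrictScalars K I))
    ⟨fun s => (degLE Δ s).map (Submodule.restrictScalars K I).mkQ,
      fun _ _ h => Submodule.map_mono (degLE_mono h)⟩
  refine ⟨Polynomial.C (hilbertFunction I s₀ : ℚ), Polynomial.natDegree_C _,
    Filter.eventually_atTop.2 ⟨s₀, fun s hs => ?_⟩⟩
  have e : (degLE Δ s₀).map (Submodule.restrictScalars K I).mkQ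
    = (degLE Δ s).map (Submodule.restrictScalars K I).mkQ := hs₀ s hs
  rw [Polynomial.eval_C, hilbertFunction_eq_finrank_map, hilbertFunction_eq_finrank_map, e]

end Finiteness

/-! ### Leading exponents and standard monomials -/

section LeadingExponents

variable {K σ : Type*} [Field K] [Fintype σ] {Δ : CommDer K σ}

omit [Fintype σ] in
theorem coeffs_term (α : σ →₀ ℕ) (a : K) : coeffs (term α a : Ore Δ) = Finsupp.single α a := rfl

theorem eq_sum_term (f : Ore Δ) :
    f = ∑ α ∈ (coeffs f).support, coeffs f α • (term α 1 : Ore Δ) := by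
  apply (coeffs (Δ := Δ)).injective
  rw [map_sum]
  simp only [map_smul, coeffs_term, Finsupp.smul_single, smul_eq_mul, mul_one]
  exact (Finsupp.sum_single (coeffs f)).symm

/-- Together with `coeffs_dmul_of_eq_zero` this gives every coefficient of `∂_i f`; splitting by
whether the exponent is positive at `i` avoids truncated subtraction. -/
theorem coeffs_dmul_add_single (i : σ) (f : Ore Δ) (γ : σ →₀ ℕ) :
    coeffs (dmul i f) (γ + Finsupp.single i 1)
      = coeffs f γ + Δ.d i (coeffs f (γ + Finsupp.single i 1)) := by
  classical
  induction f using Ore.induction with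
  | zero => simp
  | add f g hf hg =>
    simp only [map_add, Finsupp.add_apply, hf, hg]
    abel
  | term α a =>
    simp only [dmul_term, map_add, Finsupp.add_apply, coeffs_term, Finsupp.single_apply,
      add_left_inj]
    split_ifs <;> simp

theorem coeffs_dmul_of_eq_zero (i : σ) (f : Ore Δ) (γ : σ →₀ ℕ) (h : γ i = 0) :
    coeffs (dmul i f) γ = Δ.d i (coeffs f γ) := by
  classical
  induction f using Ore.induction with
  | zero => simp
  | add f g hf hg => simp only [map_add, Finsupp.add_apply, hf, hg]
  | term α a =>
    have : α + Finsupp.single i 1 ≠ γ := by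
      rintro rfl
      simp at h
    simp only [dmul_term, map_add, Finsupp.add_apply, coeffs_term, Finsupp.single_apply, this,
      if_false, zero_add]
    split_ifs <;> simp

/-- Exponents of `∂_i f` are exponents of `f`, possibly increased by one in position `i`. -/
theorem mem_support_dmul {i : σ} {f : Ore Δ} {γ : σ →₀ ℕ}
    (h : γ ∈ (coeffs (dmul i f)).support) :
    γ ∈ (coeffs f).support ∨ ∃ η ∈ (coeffs f).support, γ = η + Finsupp.single i 1 := by
  simp only [Finsupp.mem_support_iff] at h ⊢
  by_contra! hc
  obtain ⟨h1, h2⟩ := hc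
  by_cases hi : γ i = 0
  · rw [coeffs_dmul_of_eq_zero i f γ hi, h1, map_zero] at h
    exact h rfl
  · have e : γ = (γ - Finsupp.single i 1) + Finsupp.single i 1 :=
      (tsub_add_cancel_of_le (Finsupp.single_le_iff.2 (Nat.one_le_iff_ne_zero.2 hi))).symm
    have h0 : coeffs f (γ - Finsupp.single i 1) = 0 := by
      by_contra h3
      exact h2 _ h3 e
    rw [e, coeffs_dmul_add_single, h0, ← e, h1, map_zero, add_zero] at h
    exact h rfl

omit [Fintype σ] in
theorem toSyn_lt_add_single (ord : MonomialOrder σ) (i : σ) (γ : σ →₀ ℕ) :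
    ord.toSyn γ < ord.toSyn (γ + Finsupp.single i 1) := by
  refine lt_of_le_of_ne (ord.toSyn_monotone le_self_add) fun h => ?_
  have := ord.toSyn.injective h
  simp at this

/-- The derivatives of the coefficients only contribute at exponents of `f`, which lie strictly
below the shifted leading exponent. So they neither cancel nor overtake the leading term. -/
theorem IsLeadingExp.dmul {ord : MonomialOrder σ} {f : Ore Δ} {β : σ →₀ ℕ}
    (h : IsLeadingExp ord f β) (i : σ) :
    IsLeadingExp ord (Ore.dmul i f) (Finsupp.single i 1 + β) := by
  rw [add_comm]
  constructor
  · rw [Finsupp.mem_support_iff, coeffs_dmul_add_single]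
    have : coeffs f (β + Finsupp.single i 1) = 0 := by
      by_contra h0
      exact absurd (h.2 _ (Finsupp.mem_support_iff.2 h0)) (toSyn_lt_add_single ord i β).not_ge
    rw [this, map_zero, add_zero]
    exact Finsupp.mem_support_iff.1 h.1
  · intro γ hγ
    rcases mem_support_dmul hγ with h1 | ⟨η, h1, rfl⟩
    · exact (h.2 γ h1).trans (toSyn_lt_add_single ord i β).le
    · rw [map_add, map_add]
      exact add_le_add_left (h.2 η h1) _

theorem dmul_mem {I : Ideal (Ore Δ)} {f : Ore Δ} (hf : f ∈ I) (i : σ) : dmul i f ∈ I := by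
  rw [← gen_mul]
  exact I.mul_mem_left _ hf

/-- The leading exponents of a left ideal are closed under taking multiples. -/
theorem exists_isLeadingExp_of_le {ord : MonomialOrder σ} {I : Ideal (Ore Δ)} {α β : σ →₀ ℕ}
    (h : ∃ f ∈ I, IsLeadingExp ord f β) (hβ : β ≤ α) : ∃ f ∈ I, IsLeadingExp ord f α := by
  rw [← tsub_add_cancel_of_le hβ]
  induction α - β using exp_induction with
  | zero => simpa using h
  | single_add i γ ih =>
    obtain ⟨f, hf, hl⟩ := ih
    rw [add_assoc]
    exact ⟨dmul i f, dmul_mem hf i, hl.dmul i⟩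

/-- A left ideal is a Gröbner basis of itself. -/
theorem isGroebnerBasis_self (ord : MonomialOrder σ) (I : Ideal (Ore Δ)) :
    IsGroebnerBasis ord (I : Set (Ore Δ)) I := by
  refine ⟨Ideal.span_eq I, Set.ext fun α => ⟨?_, ?_⟩⟩
  · rintro ⟨f, hf, hl⟩
    exact ⟨f, hf, α, hl, le_rfl⟩
  · rintro ⟨f, hf, β, hl, hβ⟩
    exact exists_isLeadingExp_of_le ⟨f, hf, hl⟩ hβ

theorem exists_isLeadingExp (ord : MonomialOrder σ) {f : Ore Δ} (hf : f ≠ 0) :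
    ∃ α, IsLeadingExp ord f α := by
  have : (coeffs f).support.Nonempty := by
    rw [Finsupp.support_nonempty_iff]
    exact fun h => hf ((coeffs (Δ := Δ)).map_eq_zero_iff.1 h)
  obtain ⟨α, h1, h2⟩ := Finset.exists_max_image _ (fun α => ord.toSyn α) this
  exact ⟨α, h1, h2⟩

/-- The exponents that are not leading exponents of elements of `I`. -/
def standardExps (ord : MonomialOrder σ) (I : Ideal (Ore Δ)) : Set (σ →₀ ℕ) :=
  {α | ¬ ∃ f ∈ I, IsLeadingExp ord f α}

/-- The standard monomials span the quotient. -/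
theorem term_one_mem_span_standardExps (ord : MonomialOrder σ) (I : Ideal (Ore Δ))
    (α : σ →₀ ℕ) : (term α 1 : Ore Δ) ∈
      Submodule.span K ((fun β => (term β 1 : Ore Δ)) '' standardExps ord I)
        ⊔ Submodule.restrictScalars K I := by
  generalize hx : ord.toSyn α = x
  -- If `α` is the leading exponent of some `f` in `I`, then modulo `I` the monomial `∂^α` is a
  -- combination of the lower monomials of `f`, to which the induction applies.
  induction x using WellFoundedLT.induction generalizing α with
  | ind x ih =>
    subst hx
    by_cases h : α ∈ standardExps ord I
    · exact Submodule.mem_sup_left (Submodule.subset_span ⟨α, h, rfl⟩)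
    · obtain ⟨f, hf, hl⟩ := not_not.1 h
      have e := eq_sum_term f
      rw [← Finset.add_sum_erase _ _ hl.1] at e
      have hc : coeffs f α ≠ 0 := Finsupp.mem_support_iff.1 hl.1
      rw [← inv_smul_smul₀ hc (term α 1 : Ore Δ)]
      refine Submodule.smul_mem _ _ ?_
      rw [eq_sub_of_add_eq e.symm]
      refine Submodule.sub_mem _ (Submodule.mem_sup_right hf) (Submodule.sum_mem _ fun β hβ => ?_)
      refine Submodule.smul_mem _ _ (ih _ ?_ β rfl)
      refine lt_of_le_of_ne (hl.2 β (Finset.mem_of_mem_erase hβ)) fun h => ?_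
      exact Finset.ne_of_mem_erase hβ (ord.toSyn.injective h)

theorem mem_span_standardExps (ord : MonomialOrder σ) (I : Ideal (Ore Δ)) (f : Ore Δ) :
    f ∈ Submodule.span K ((fun β => (term β 1 : Ore Δ)) '' standardExps ord I)
        ⊔ Submodule.restrictScalars K I := by
  rw [eq_sum_term f]
  exact Submodule.sum_mem _ fun α _ =>
    Submodule.smul_mem _ _ (term_one_mem_span_standardExps ord I α)

theorem finite_of_finite_standardExps {ord : MonomialOrder σ} {I : Ideal (Ore Δ)}
    (h : (standardExps ord I).Finite) :
    Module.Finite K (Ore Δ ⧸ Submodule.restrictScalars K I) := by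
  refine ⟨⟨(h.image fun β => (Submodule.restrictScalars K I).mkQ (term β 1)).toFinset,
    eq_top_iff.2 fun x _ => ?_⟩⟩
  obtain ⟨f, rfl⟩ := Submodule.mkQ_surjective _ x
  obtain ⟨g, hg, r, hr, rfl⟩ := Submodule.mem_sup.1 (mem_span_standardExps ord I f)
  have : (Submodule.restrictScalars K I).mkQ r = 0 := by simpa using hr
  rw [map_add, this, add_zero, Set.Finite.coe_toFinset,
    ← Set.image_image (Submodule.restrictScalars K I).mkQ, Submodule.span_image]
  exact Submodule.mem_map_of_mem hg

/-- Standard monomials are independent modulo `I`: a nontrivial relation would be a nonzero element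
of `I` whose leading exponent is standard. -/
theorem finite_standardExps (ord : MonomialOrder σ) {I : Ideal (Ore Δ)}
    (h : Module.Finite K (Ore Δ ⧸ Submodule.restrictScalars K I)) :
    (standardExps ord I).Finite := by
  have : LinearIndependent K
      (fun b : standardExps ord I => (Submodule.restrictScalars K I).mkQ (term b.1 1)) := by
    rw [linearIndependent_iff']
    intro s g hg b hb
    by_contra hne
    simp only [← map_smul, ← map_sum] at hg
    have hI : ∑ b ∈ s, g b • (term b.1 1 : Ore Δ) ∈ I :=
      (Submodule.Quotient.mk_eq_zero (Submodule.restrictScalars K I)).1 hg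
    have hco : ∀ γ, coeffs (∑ b ∈ s, g b • (term b.1 1 : Ore Δ)) γ
        = ∑ b ∈ s, (Finsupp.single b.1 (g b)) γ := by
      intro γ
      simp only [map_sum, map_smul, coeffs_term, Finsupp.smul_single, smul_eq_mul, mul_one,
        Finsupp.finsetSum_apply]
    have h0 : (∑ b ∈ s, g b • (term b.1 1 : Ore Δ)) ≠ 0 := by
      intro h0
      have h1 := hco b.1
      rw [h0, map_zero, Finsupp.zero_apply, Finset.sum_eq_single b] at h1
      · exact hne (by simpa using h1.symm)
      · intro c _ hc
        exact Finsupp.single_eq_of_ne' (fun h => hc (Subtype.ext h))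
      · exact fun h => absurd hb h
    obtain ⟨γ, hγ⟩ := exists_isLeadingExp ord h0
    refine absurd ⟨_, hI, hγ⟩ (?_ : γ ∈ standardExps ord I)
    obtain ⟨c, _, hc⟩ := Finset.exists_ne_zero_of_sum_ne_zero
      ((hco γ).symm.trans_ne (Finsupp.mem_support_iff.1 hγ.1))
    have : c.1 = γ := by
      by_contra h
      exact hc (Finsupp.single_eq_of_ne' h)
    exact this ▸ c.2
  exact this.finite

end LeadingExponents

end Ore

/-! ### Linear growth of the coefficients in reductions modulo the ideal -/

section Growth

open MvPolynomial in
theorem totalDegree_pderiv_le {R σ : Type*} [CommSemiring R] (i : σ) (p : MvPolynomial σ R) :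
    (pderiv i p).totalDegree ≤ p.totalDegree := by
  conv_lhs => rw [p.as_sum, map_sum]
  refine totalDegree_finsetSum_le fun s hs => ?_
  rw [pderiv_monomial]
  refine (totalDegree_monomial_le _ _).trans ?_
  refine le_trans ?_ (le_totalDegree hs)
  change Finsupp.degree (s - Finsupp.single i 1) ≤ Finsupp.degree s
  exact Finsupp.degree_mono tsub_le_self

/-- Finitely many rational functions have a common denominator. -/
theorem exists_common_denominator {C σ ι : Type*} [Field C] [Finite ι] (f : ι → MvRat C σ) :
    ∃ q : MvPolynomial σ C, q ≠ 0 ∧ ∃ w : ι → MvPolynomial σ C,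
      ∀ i, algebraMap _ (MvRat C σ) q * f i = algebraMap _ _ (w i) := by
  obtain ⟨q, hq⟩ := IsLocalization.exist_integer_multiples_of_finite
    (nonZeroDivisors (MvPolynomial σ C)) f
  choose w hw using hq
  refine ⟨q.1, nonZeroDivisors.ne_zero q.2, w, fun i => ?_⟩
  rw [hw i, ← Algebra.smul_def]

namespace Ore

theorem exists_sub_sum_mem {K σ : Type*} [Field K] [Fintype σ] {Δ : CommDer K σ}
    (ord : MonomialOrder σ) (I : Ideal (Ore Δ)) [Fintype (standardExps ord I)] (f : Ore Δ) :
    ∃ v : standardExps ord I → K, f - ∑ b, term b.1 (v b) ∈ I := by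
  obtain ⟨g, hg, r, hr, rfl⟩ := Submodule.mem_sup.1 (mem_span_standardExps ord I f)
  rw [Set.image_eq_range, Submodule.mem_span_range_iff_exists_fun] at hg
  obtain ⟨v, rfl⟩ := hg
  refine ⟨v, ?_⟩
  simp only [smul_term, mul_one, add_sub_cancel_left]
  exact hr

theorem smul_mem {K σ : Type*} [Field K] [Fintype σ] {Δ : CommDer K σ} {I : Ideal (Ore Δ)}
    {f : Ore Δ} (hf : f ∈ I) (a : K) : a • f ∈ I :=
  (Submodule.restrictScalars K I).smul_mem a hf

theorem term_sum {K σ ι : Type*} [CommRing K] {Δ : CommDer K σ} (α : σ →₀ ℕ) (s : Finset ι)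
    (f : ι → K) : (term α (∑ i ∈ s, f i) : Ore Δ) = ∑ i ∈ s, term α (f i) :=
  map_sum (termHom α) f s

theorem term_sub {K σ : Type*} [CommRing K] {Δ : CommDer K σ} (α : σ →₀ ℕ)
    (a b : K) : (term α (a - b) : Ore Δ) = term α a - term α b :=
  map_sub (termHom α) a b

variable {C σ : Type*} [Field C] [Fintype σ]

/-- If the monomials `∂^(e b)` span the quotient by `I`, then `q^(|α| + 1) ∂^α` is congruent to a
combination of them with polynomial coefficients of degree linear in `|α|`. -/
theorem exists_linear_growth {B : Type*} [Fintype B] (e : B → σ →₀ ℕ) (I : Ideal (DOre C σ))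
    (h : ∀ f : DOre C σ, ∃ v : B → MvRat C σ, f - ∑ b, term (e b) (v b) ∈ I) :
    ∃ q : MvPolynomial σ C, q ≠ 0 ∧ ∃ D : ℕ, q.totalDegree ≤ D ∧
      ∀ α : σ →₀ ℕ, ∃ w : B → MvPolynomial σ C,
      (∀ b, (w b).totalDegree ≤ (α.degree + 1) * D) ∧
      (term α (algebraMap _ _ (q ^ (α.degree + 1))) - ∑ b, term (e b) (algebraMap _ _ (w b)) :
        DOre C σ) ∈ I := by
  choose v hv using h
  -- The only denominators that ever arise are those in the coordinates of 1 and of each `∂_i ∂^(e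
  -- b)`; finitely many, hence one `q`.
  obtain ⟨q, hq, w, hw⟩ := exists_common_denominator
    (Sum.elim (v (term 0 1)) (fun x : σ × B × B =>
      v (term (e x.2.1 + Finsupp.single x.1 1) 1) x.2.2))
  obtain ⟨D, hD⟩ : ∃ D, ∀ x, (w x).totalDegree ≤ D :=
    ⟨Finset.univ.sup fun x => (w x).totalDegree,
      fun x => Finset.le_sup (f := fun x => (w x).totalDegree) (Finset.mem_univ x)⟩
  refine ⟨q, hq, max q.totalDegree D, le_max_left _ _, fun α => ?_⟩
  have hqD := le_max_left q.totalDegree D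
  replace hD := fun x => (hD x).trans (le_max_right q.totalDegree D)
  generalize max q.totalDegree D = D at hqD hD
  have scale : ∀ γ, (term γ (algebraMap _ _ q) -
      ∑ b, term (e b) (algebraMap _ _ q * v (term γ 1) b) : DOre C σ) ∈ I := fun γ => by
    have := smul_mem (hv (term γ 1)) (algebraMap _ _ q)
    simpa only [smul_sub, Finset.smul_sum, smul_term, mul_one] using this
  induction α using exp_induction with
  | zero =>
    refine ⟨fun b => w (Sum.inl b), fun b => by simpa using hD _, ?_⟩
    simpa [← hw] using scale 0
  | single_add i α ih =>
    obtain ⟨u, hu, hI⟩ := ih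
    have hdeg : (Finsupp.single i 1 + α).degree = α.degree + 1 := by
      rw [map_add, Finsupp.degree_single, add_comm]
    rw [hdeg]
    generalize α.degree + 1 = n at *
    -- Apply `q ∂_i` to `q^n ∂^α ≡ ∑ u_b ∂^(e b)`. The term `n q' q^n ∂^α` produced by
    -- differentiating `q^n` is removed with the same relation, and each `q ∂_i ∂^(e b)` is replaced
    -- using `w`. Every summand has degree at most `D` more than the bound for `u`.
    refine ⟨fun b => q * MvPolynomial.pderiv i (u b) - n * MvPolynomial.pderiv i q * u b
      + ∑ c, u c * w (Sum.inr (i, c, b)), fun b => ?_, ?_⟩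
    · have e1 : (n + 1) * D = D + n * D := by ring
      refine (MvPolynomial.totalDegree_add _ _).trans (max_le
        ((MvPolynomial.totalDegree_sub _ _).trans (max_le ?_ ?_))
        (MvPolynomial.totalDegree_finsetSum_le fun c _ => ?_))
      · rw [e1]
        exact (MvPolynomial.totalDegree_mul _ _).trans
          (add_le_add hqD ((totalDegree_pderiv_le i _).trans (hu b)))
      · rw [e1]
        refine (MvPolynomial.totalDegree_mul _ _).trans (add_le_add ?_ (hu b))
        refine (MvPolynomial.totalDegree_mul _ _).trans ?_
        have : (n : MvPolynomial σ C).totalDegree = 0 := by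
          rw [← map_natCast (MvPolynomial.C : C →+* MvPolynomial σ C), MvPolynomial.totalDegree_C]
        rw [this, zero_add]
        exact (totalDegree_pderiv_le i _).trans hqD
      · rw [e1, add_comm]
        exact (MvPolynomial.totalDegree_mul _ _).trans (add_le_add (hu c) (hD _))
    · have h1 := smul_mem (dmul_mem hI i) (algebraMap _ (MvRat C σ) q)
      have h2 := smul_mem hI (algebraMap _ (MvRat C σ) (n * MvPolynomial.pderiv i q))
      have h3 : ∑ b, algebraMap _ (MvRat C σ) (u b) •
          (term (e b + Finsupp.single i 1) (algebraMap _ _ q) -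
            ∑ c, term (e c) (algebraMap _ _ (w (Sum.inr (i, b, c)))) : DOre C σ) ∈ I := by
        refine Submodule.sum_mem _ fun b _ => smul_mem ?_ _
        simpa [← hw] using scale (e b + Finsupp.single i 1)
      have h4 := I.add_mem (I.sub_mem h1 h2) h3
      convert h4 using 1
      have hd : ∀ p : MvPolynomial σ C, (partials C σ).d i (algebraMap _ _ p)
          = algebraMap _ _ (MvPolynomial.pderiv i p) := fun p => pderivAdd_algebraMap i p
      have hpow : q * MvPolynomial.pderiv i (q ^ n)
          = n * MvPolynomial.pderiv i q * q ^ n := by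
        -- After the generalization `n` may be 0; multiplying by `q` avoids the exponent `n - 1`.
        rcases n with _ | n
        · simp
        · simp [Derivation.leibniz_pow]
          ring
      simp only [map_sub, map_sum, dmul_term, hd, smul_sub, smul_add, Finset.smul_sum, smul_term,
        ← map_mul, hpow, Finset.sum_sub_distrib, Finset.sum_add_distrib, term_add, map_add,
        term_sub, term_sum]
      rw [Finset.sum_comm (f := fun x y => term (e x) _), add_comm α, pow_succ']
      simp only [mul_comm q (u _)]
      abel

/-- A version of `exists_linear_growth` with the same factor for all monomials of degree at most
`s`. -/
theorem exists_uniform_linear_growth {B : Type*} [Fintype B] (e : B → σ →₀ ℕ)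
    (I : Ideal (DOre C σ))
    (h : ∀ f : DOre C σ, ∃ v : B → MvRat C σ, f - ∑ b, term (e b) (v b) ∈ I) :
    ∃ q : MvPolynomial σ C, q ≠ 0 ∧ ∃ D : ℕ, ∀ (s : ℕ) (α : σ →₀ ℕ), α.degree ≤ s →
      ∃ w : B → MvPolynomial σ C, (∀ b, (w b).totalDegree ≤ (s + 1) * D) ∧
      (term α (algebraMap _ _ (q ^ (s + 1))) - ∑ b, term (e b) (algebraMap _ _ (w b)) :
        DOre C σ) ∈ I := by
  obtain ⟨q, hq, D, hqD, H⟩ := exists_linear_growth e I h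
  refine ⟨q, hq, D, fun s α hα => ?_⟩
  obtain ⟨w, hw, hI⟩ := H α
  obtain ⟨n, rfl⟩ := Nat.exists_eq_add_of_le hα
  -- Here `n = s - |α|`: the missing powers of `q` are supplied on both sides.
  refine ⟨fun b => q ^ n * w b, fun b => ?_, ?_⟩
  · refine (MvPolynomial.totalDegree_mul _ _).trans ((add_le_add
      ((MvPolynomial.totalDegree_pow _ _).trans (Nat.mul_le_mul_left n hqD)) (hw b)).trans ?_)
    exact le_of_eq (by ring)
  · have := smul_mem hI (algebraMap _ (MvRat C σ) (q ^ n))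
    rw [smul_sub, smul_term, Finset.smul_sum, ← map_mul, ← pow_add] at this
    simp only [smul_term, ← map_mul] at this
    rwa [show α.degree + n + 1 = n + (α.degree + 1) by ring]

theorem exists_eq_of_mem_support_sum_term {K B σ : Type*} [CommRing K]
    {Δ : CommDer K σ} {s : Finset B} {e : B → σ →₀ ℕ} {f : B → K} {γ : σ →₀ ℕ}
    (h : γ ∈ (coeffs (∑ b ∈ s, term (e b) (f b) : Ore Δ)).support) : ∃ b ∈ s, e b = γ := by
  rw [Finsupp.mem_support_iff, map_sum, Finsupp.finsetSum_apply] at h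
  obtain ⟨b, hb, hne⟩ := Finset.exists_ne_zero_of_sum_ne_zero h
  exact ⟨b, hb, by_contra fun hc => hne (Finsupp.single_eq_of_ne' hc)⟩

end Ore

end Growth

/-! ### Polynomial growth 1 -/

section PolynomialGrowth

variable {C ξ τ : Type*} [Field C]

theorem IsPolyT.zero {n : ℕ} : IsPolyT C n (0 : MvRat C (ξ ⊕ τ)) :=
  ⟨0, by simp, map_zero _⟩

theorem IsPolyT.sum {ι : Type*} {n : ℕ} {s : Finset ι} {f : ι → MvRat C (ξ ⊕ τ)}
    (h : ∀ i ∈ s, IsPolyT C n (f i)) : IsPolyT C n (∑ i ∈ s, f i) := by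
  choose! q hq using h
  exact ⟨∑ i ∈ s, q i, MvPolynomial.totalDegree_finsetSum_le fun i hi => (hq i hi).1, by
    rw [map_sum]
    exact Finset.sum_congr rfl fun i hi => (hq i hi).2⟩

/-- Rewriting `p` in `C(x)[t]` makes each `x_i` a constant and keeps each `t_j` of degree 1, so the
degree in `t` is at most the total degree in `x` and `t`. -/
theorem isPolyT_algebraMap [Fintype ξ] [Fintype τ] {n : ℕ} {p : MvPolynomial (ξ ⊕ τ) C}
    (h : p.totalDegree ≤ n) : IsPolyT C n (algebraMap _ (MvRat C (ξ ⊕ τ)) p) := by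
  let g : ξ ⊕ τ → MvPolynomial τ (MvRat C ξ) :=
    Sum.elim (fun i => MvPolynomial.C (algebraMap (MvPolynomial ξ C) _ (MvPolynomial.X i)))
      MvPolynomial.X
  let φ : C →+* MvPolynomial τ (MvRat C ξ) :=
    MvPolynomial.C.comp ((algebraMap (MvPolynomial ξ C) (MvRat C ξ)).comp MvPolynomial.C)
  refine ⟨MvPolynomial.eval₂Hom φ g p, ?_, ?_⟩
  · rw [MvPolynomial.coe_eval₂Hom, MvPolynomial.eval₂_eq']
    refine MvPolynomial.totalDegree_finsetSum_le fun d hd => ?_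
    refine (MvPolynomial.totalDegree_mul _ _).trans ?_
    have : (φ (p.coeff d)).totalDegree = 0 := MvPolynomial.totalDegree_C _
    rw [this, zero_add]
    refine (MvPolynomial.totalDegree_finsetProd _ _).trans (le_trans ?_
      ((MvPolynomial.le_totalDegree hd).trans h))
    rw [Finsupp.sum_fintype _ _ fun _ => rfl]
    refine Finset.sum_le_sum fun i _ => (MvPolynomial.totalDegree_pow _ _).trans ?_
    have : (g i).totalDegree ≤ 1 := by
      rcases i with i | j
      · exact (MvPolynomial.totalDegree_C _).trans_le zero_le_one
      · exact (MvPolynomial.totalDegree_X j).le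
    simpa using Nat.mul_le_mul_left (d i) this
  · have : (polyT C).comp (MvPolynomial.eval₂Hom φ g)
        = algebraMap (MvPolynomial (ξ ⊕ τ) C) (MvRat C (ξ ⊕ τ)) := by
      refine MvPolynomial.ringHom_ext (fun a => ?_) (fun i => ?_)
      · simp [φ, polyT, inclX_algebraMap]
      · rcases i with i | j <;> simp [g, polyT, inclX_algebraMap]
    exact congrArg (fun F : MvPolynomial (ξ ⊕ τ) C →+* MvRat C (ξ ⊕ τ) => F p) this

theorem isBigO_linear (D : ℕ) : (fun s => (((s + 1) * D : ℕ) : ℝ)) =O[Filter.atTop]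
    (fun s : ℕ => (s : ℝ) ^ 1) := by
  refine Asymptotics.IsBigO.of_bound (2 * D) (Filter.eventually_atTop.2 ⟨1, fun s hs => ?_⟩)
  have : (1 : ℝ) ≤ s := by exact_mod_cast hs
  have hD : (0 : ℝ) ≤ D := D.cast_nonneg
  rw [Real.norm_natCast, pow_one, Real.norm_natCast]
  push_cast
  nlinarith

/-- A remainder supported on standard monomials is a normal form, so the linear growth bound applies
directly. As a Gröbner basis, the whole ideal `I` serves. -/
theorem hasPolynomialGrowthWrt_one [Fintype ξ] [Fintype τ] (ord : MonomialOrder (ξ ⊕ τ))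
    {I : Ideal (DOre C (ξ ⊕ τ))} (hI : Ore.HasHilbertDim I 0) :
    HasPolynomialGrowthWrt ord I 1 := by
  have := (Ore.finite_standardExps ord (Ore.finite_of_hasHilbertDim_zero hI)).fintype
  obtain ⟨q, hq, D, H⟩ := Ore.exists_uniform_linear_growth
    (fun b : Ore.standardExps ord I => b.1) I (Ore.exists_sub_sum_mem ord I)
  refine ⟨I, Ore.isGroebnerBasis_self ord I, fun s => q ^ (s + 1), fun s => (s + 1) * D,
    fun s => pow_ne_zero _ hq, isBigO_linear D, fun s α hα => ?_⟩
  obtain ⟨w, hw, hI⟩ := H s α hα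
  refine ⟨∑ b, Ore.term b.1 (algebraMap _ _ (w b)), ⟨?_, fun γ hγ g hg β hβ hle => ?_⟩, fun γ => ?_⟩
  · rw [Ideal.span_eq]
    exact hI
  · obtain ⟨b, _, rfl⟩ := Ore.exists_eq_of_mem_support_sum_term hγ
    exact b.2 (Ore.exists_isLeadingExp_of_le ⟨g, hg, hβ⟩ hle)
  · rw [map_sum, Finsupp.finsetSum_apply]
    refine IsPolyT.sum fun b _ => ?_
    classical
    rw [Ore.coeffs_term, Finsupp.single_apply]
    split_ifs
    · exact isPolyT_algebraMap (hw b)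
    · exact IsPolyT.zero

theorem exists_isGraded (σ : Type) [Finite σ] :
    ∃ ord : MonomialOrder.{0, 0} σ, Ore.IsGraded ord := by
  obtain ⟨n, ⟨e⟩⟩ := Finite.exists_equiv_fin σ
  let _ : LinearOrder σ := LinearOrder.lift' e e.injective
  refine ⟨MonomialOrder.degLex, fun α β h => ?_⟩
  rw [MonomialOrder.degLex_lt_iff, Finsupp.DegLex.lt_iff]
  exact Or.inl h

end PolynomialGrowth

/-! ### Elimination of `t` by counting dimensions -/

section Elimination

variable {C ξ τ : Type*} [Field C] [Fintype ξ] [Fintype τ]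

/-- The exponent of `∂_i^a ∂_t^β`. -/
noncomputable def mixedExp (i : ξ) (a : ℕ) (β : τ →₀ ℕ) : ξ ⊕ τ →₀ ℕ :=
  β.mapDomain Sum.inr + (Finsupp.single i a).mapDomain Sum.inl

omit [Fintype ξ] [Fintype τ] in
theorem degree_mixedExp (i : ξ) (a : ℕ) (β : τ →₀ ℕ) :
    (mixedExp i a β).degree = β.degree + a := by
  rw [mixedExp, map_add, Finsupp.mapDomain_single, Finsupp.degree_single,
    Finsupp.degree_mapDomain]

/-- Exponents in the box `[0, n)^τ`. -/
noncomputable def boxExp {n : ℕ} (β : τ → Fin n) : τ →₀ ℕ := Finsupp.equivFunOnFinite.symm fun j => (β j : ℕ)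

theorem boxExp_injective {n : ℕ} : Function.Injective (boxExp (τ := τ) (n := n)) := by
  intro β γ h
  funext j
  exact Fin.ext (DFunLike.congr_fun h j)

theorem degree_boxExp_le {n : ℕ} (β : τ → Fin n) :
    (boxExp β).degree ≤ Fintype.card τ * n := by
  rw [Finsupp.degree_eq_sum]
  refine (Finset.sum_le_card_nsmul _ _ n fun j _ => (β j).2.le).trans ?_
  rfl

/-- Elimination of `t`: an ideal of finite codimension contains a nonzero operator
in `∂_i` and `∂_t` whose coefficients do not involve `t`. -/
theorem exists_operator_free_of_t [DecidableEq τ] {B : Type*} [Fintype B] (e : B → ξ ⊕ τ →₀ ℕ)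
    (I : Ideal (DOre C (ξ ⊕ τ)))
    (h : ∀ f : DOre C (ξ ⊕ τ), ∃ v : B → MvRat C (ξ ⊕ τ), f - ∑ b, Ore.term (e b) (v b) ∈ I)
    (i : ξ) :
    ∃ (n : ℕ) (c : Fin n × (τ → Fin n) → MvRat C ξ), (∃ x, c x ≠ 0) ∧
      (∑ x, Ore.term (mixedExp i x.1 (boxExp x.2)) (inclX C ξ τ (c x)) : DOre C (ξ ⊕ τ)) ∈ I := by
  obtain ⟨q, hq, D, H⟩ := Ore.exists_uniform_linear_growth e I h
  set k := Fintype.card τ with hk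
  -- Chosen so that `n * n ^ k` unknowns exceed the equations: one for each `b` and each monomial in
  -- `t` with exponents at most `E`. All monomials used have degree at most `s = (k + 1) n`, so `E +
  -- 1 ≤ ((k + 2) D + 1) n` and there are at most `(n - 1) n ^ k` equations.
  set n := Fintype.card B * ((k + 2) * D + 1) ^ k + 1 with hn
  set s := k * n + n with hs
  have hdeg : ∀ x : Fin n × (τ → Fin n), (mixedExp i x.1 (boxExp x.2)).degree ≤ s := fun x => by
    rw [degree_mixedExp]
    exact add_le_add (degree_boxExp_le _) x.1.2.le
  choose w hw hI using fun x => H s _ (hdeg x)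
  choose p hp hpw using fun x b => isPolyT_algebraMap (hw x b)
  set E := (s + 1) * D with hE
  have hcard : Fintype.card B * (E + 1) ^ k < n * n ^ k := by
    have h1 : E + 1 ≤ ((k + 2) * D + 1) * n := by
      have : 1 ≤ n := by omega
      rw [hE, hs]
      nlinarith [Nat.zero_le D, Nat.zero_le k, Nat.mul_le_mul_left D this]
    calc Fintype.card B * (E + 1) ^ k
        ≤ Fintype.card B * (((k + 2) * D + 1) * n) ^ k := by gcongr
      _ = (n - 1) * n ^ k := by rw [mul_pow, ← mul_assoc, hn, Nat.add_sub_cancel]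
      _ < n * n ^ k := by
        have : 0 < n := by omega
        have := pow_pos this k
        exact Nat.mul_lt_mul_of_pos_right (by omega) this
  have hdep : ¬ LinearIndependent (MvRat C ξ) (fun (x : Fin n × (τ → Fin n))
      (y : B × (τ → Fin (E + 1))) => (p x y.1).coeff (boxExp y.2)) := by
    intro hli
    have := hli.fintype_card_le_finrank
    rw [Module.finrank_fintype_fun_eq_card] at this
    simp only [Fintype.card_prod, Fintype.card_fin, Fintype.card_fun] at this
    exact absurd hcard this.not_gt
  obtain ⟨c, hc, hne⟩ := Fintype.not_linearIndependent_iff.1 hdep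
  refine ⟨n, c, hne, ?_⟩
  -- The dependency only speaks of coefficients in the box `[0, E]^τ`; those outside vanish because
  -- the total degree in `t` is at most `E`.
  have hz : ∀ b, ∑ x, inclX C ξ τ (c x) * algebraMap _ _ (w x b) = 0 := fun b => by
    have : ∑ x, MvPolynomial.C (c x) * p x b = 0 := by
      ext γ
      rw [MvPolynomial.coeff_sum, MvPolynomial.coeff_zero]
      simp only [MvPolynomial.coeff_C_mul]
      by_cases hγ : ∀ j, γ j < E + 1
      · have := congrFun hc (b, fun j => ⟨γ j, hγ j⟩)
        rw [Finset.sum_apply] at this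
        have hb : boxExp (fun j => (⟨γ j, hγ j⟩ : Fin (E + 1))) = γ := by
          ext j
          rfl
        simpa [hb] using this
      · refine Finset.sum_eq_zero fun x _ => ?_
        push Not at hγ
        obtain ⟨j, hj⟩ := hγ
        rw [MvPolynomial.coeff_eq_zero_of_totalDegree_lt, mul_zero]
        refine ((hp x b).trans_lt hj).trans_le ?_
        exact Finsupp.le_degree j γ
    have := congrArg (polyT C) this
    rw [map_sum, map_zero] at this
    simp only [map_mul, hpw] at this
    simpa [polyT] using this
  have hQ : algebraMap _ (MvRat C (ξ ⊕ τ)) (q ^ (s + 1)) ≠ 0 := by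
    simpa using hq
  have hmem : ∑ x, inclX C ξ τ (c x) • (Ore.term (mixedExp i x.1 (boxExp x.2))
      (algebraMap _ _ (q ^ (s + 1))) - ∑ b, Ore.term (e b) (algebraMap _ _ (w x b)) :
        DOre C (ξ ⊕ τ)) ∈ I :=
    Submodule.sum_mem _ fun x _ => Ore.smul_mem (hI x) _
  simp only [smul_sub, Finset.smul_sum, Ore.smul_term, Finset.sum_sub_distrib] at hmem
  rw [Finset.sum_comm (f := fun x b => Ore.term (e b) _)] at hmem
  simp only [← Ore.term_sum, hz, Ore.term_zero, Finset.sum_const_zero, sub_zero] at hmem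
  -- The factor `q^(s+1)` is the same for all monomials and stands on the left, so it can be divided
  -- out; this is where uniformity in `α` matters.
  have := Ore.smul_mem hmem (algebraMap _ (MvRat C (ξ ⊕ τ)) (q ^ (s + 1)))⁻¹
  rw [Finset.smul_sum] at this
  convert this using 2 with x
  rw [Ore.smul_term, mul_comm, mul_assoc, mul_inv_cancel₀ hQ, mul_one]

end Elimination

/-! ### Integration by parts and the telescoping ideal -/

section Telescoping

variable {C ξ τ : Type*} [Field C]

/-- The rational function `c(x) t^β`. -/
noncomputable def mulMonomialT (c : MvRat C ξ) (β : τ →₀ ℕ) : MvRat C (ξ ⊕ τ) :=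
  inclX C ξ τ c * algebraMap (MvPolynomial (ξ ⊕ τ) C) _
    (MvPolynomial.monomial (β.mapDomain Sum.inr) 1)

theorem mulMonomialT_zero (c : MvRat C ξ) :
    mulMonomialT c (0 : τ →₀ ℕ) = inclX C ξ τ c := by
  rw [mulMonomialT, Finsupp.mapDomain_zero, MvPolynomial.monomial_zero', map_one, map_one,
    mul_one]

theorem mulMonomialT_mul_inclX (c c' : MvRat C ξ) (β : τ →₀ ℕ) :
    mulMonomialT c β * inclX C ξ τ c' = mulMonomialT (c * c') β := by
  rw [mulMonomialT, mulMonomialT, map_mul]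
  ring

theorem pderivAdd_mulMonomialT (j : τ) (c : MvRat C ξ) (β : τ →₀ ℕ) :
    pderivAdd (Sum.inr j) (mulMonomialT c β)
      = mulMonomialT ((β j : MvRat C ξ) * c) (β - Finsupp.single j 1) := by
  rw [mulMonomialT, pderivAdd_mul, pderivAdd_inclX, mul_zero, add_zero, pderivAdd_algebraMap,
    MvPolynomial.pderiv_monomial, Finsupp.mapDomain_apply Sum.inr_injective, mulMonomialT,
    one_mul]
  have h1 : MvPolynomial.monomial (β.mapDomain Sum.inr - Finsupp.single (Sum.inr j : ξ ⊕ τ) 1)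
      (β j : C) = (β j : MvPolynomial (ξ ⊕ τ) C) *
        MvPolynomial.monomial ((β - Finsupp.single j 1).mapDomain Sum.inr) 1 := by
    have h2 : (β - Finsupp.single j 1).mapDomain (Sum.inr : τ → ξ ⊕ τ)
        = β.mapDomain Sum.inr - Finsupp.single (Sum.inr j : ξ ⊕ τ) 1 := by
      classical
      ext (i | l)
      · rw [Finsupp.mapDomain_of_notMem_range _ _ (by simp), Finsupp.tsub_apply,
          Finsupp.mapDomain_of_notMem_range _ _ (by simp), Nat.zero_sub]
      · rw [Finsupp.mapDomain_apply Sum.inr_injective, Finsupp.tsub_apply, Finsupp.tsub_apply,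
          Finsupp.mapDomain_apply Sum.inr_injective, Finsupp.single_apply, Finsupp.single_apply]
        simp
    rw [h2, ← map_natCast (MvPolynomial.C : C →+* _), MvPolynomial.C_mul_monomial, mul_one]
  rw [h1, map_mul, map_mul, map_natCast, map_natCast]
  ring

variable [Fintype ξ] [Fintype τ]

variable (C ξ τ) in
/-- The right ideal `∑_j ∂_{t_j} C(x,t)⟨∂_x, ∂_t⟩`. -/
noncomputable def derivSum : AddSubgroup (DOre C (ξ ⊕ τ)) :=
  ⨆ j : τ, (AddMonoidHom.mulLeft (Ore.gen (Sum.inr j : ξ ⊕ τ))).range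

/-- Integration by parts. -/
theorem term_add_term_mem_derivSum (j : τ) (γ : ξ ⊕ τ →₀ ℕ) (a : MvRat C (ξ ⊕ τ)) :
    (Ore.term (Finsupp.single (Sum.inr j) 1 + γ) a + Ore.term γ (pderivAdd (Sum.inr j) a) :
      DOre C (ξ ⊕ τ)) ∈ derivSum C ξ τ := by
  refine AddSubgroup.mem_iSup_of_mem j ⟨Ore.term γ a, ?_⟩
  change Ore.gen _ * Ore.term γ a = _
  rw [Ore.gen_mul, Ore.dmul_term, add_comm γ]
  rfl

/-- Each integration by parts moves one `∂_{t_j}` onto `t^β` and lowers both exponents at `j`. As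
`γ` exceeds `β` somewhere, a derivative eventually hits a coefficient free of `t_j` and gives 0. -/
theorem term_mulMonomialT_mem_derivSum {γ β : τ →₀ ℕ} (h : ¬ γ ≤ β) (η : ξ ⊕ τ →₀ ℕ)
    (c : MvRat C ξ) :
    (Ore.term (γ.mapDomain Sum.inr + η) (mulMonomialT c β) : DOre C (ξ ⊕ τ))
      ∈ derivSum C ξ τ := by
  induction γ using Ore.exp_induction generalizing β c with
  | zero => exact absurd zero_le h
  | single_add j γ ih =>
    have := term_add_term_mem_derivSum j (γ.mapDomain Sum.inr + η) (mulMonomialT c β)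
    rw [← add_assoc, ← Finsupp.mapDomain_single, ← Finsupp.mapDomain_add] at this
    refine (AddSubgroup.add_mem_cancel_right _ ?_).1 this
    rw [pderivAdd_mulMonomialT]
    by_cases hj : β j = 0
    · rw [hj, Nat.cast_zero, zero_mul, mulMonomialT, map_zero, zero_mul, Ore.term_zero]
      exact zero_mem _
    · refine ih (fun hle => h ?_) _
      rw [← tsub_add_cancel_of_le (Finsupp.single_le_iff.2 (Nat.one_le_iff_ne_zero.2 hj)),
        add_comm]
      exact add_le_add_left hle _

variable (C ξ) in
/-- Up to derivatives, `t^β ∂_t^β` is a nonzero integer. -/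
theorem exists_term_mulMonomialT_sub_mem_derivSum (β : τ →₀ ℕ) : ∃ u : ℤ, u ≠ 0 ∧
    ∀ (η : ξ ⊕ τ →₀ ℕ) (c : MvRat C ξ),
      (Ore.term (β.mapDomain Sum.inr + η) (mulMonomialT c β)
        - Ore.term η (inclX C ξ τ (u * c)) : DOre C (ξ ⊕ τ)) ∈ derivSum C ξ τ := by
  induction β using Ore.exp_induction with
  | zero =>
    refine ⟨1, one_ne_zero, fun η c => ?_⟩
    rw [mulMonomialT_zero, Finsupp.mapDomain_zero, zero_add, Int.cast_one, one_mul, sub_self]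
    exact zero_mem _
  | single_add j β ih =>
    obtain ⟨u, hu, H⟩ := ih
    -- The sign comes from integrating by parts and `β j + 1` from differentiating `t_j^(β j + 1)`;
    -- the recursion yields `(-1)^|β| β!`.
    refine ⟨-(u * (β j + 1)), neg_ne_zero.2 (mul_ne_zero hu (by positivity)), fun η c => ?_⟩
    have h1 := term_add_term_mem_derivSum j (β.mapDomain Sum.inr + η)
      (mulMonomialT c (Finsupp.single j 1 + β))
    rw [pderivAdd_mulMonomialT, add_tsub_cancel_left, ← add_assoc, ← Finsupp.mapDomain_single,
      ← Finsupp.mapDomain_add] at h1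
    have h2 := sub_mem h1 (H η (((Finsupp.single j 1 + β : τ →₀ ℕ) j : MvRat C ξ) * c))
    rw [add_sub_assoc, sub_sub_cancel] at h2
    convert h2 using 1
    rw [sub_eq_add_neg]
    congr 1
    rw [neg_eq_iff_add_eq_zero, ← Ore.term_add, ← map_add]
    convert Ore.term_zero η
    rw [← map_zero (inclX C ξ τ)]
    congr 1
    simp only [Finsupp.add_apply, Finsupp.single_eq_same]
    push_cast
    ring

/-- A nonzero operator in `∂_i` and `∂_t` in `I` whose coefficients do not involve `t` yields a
nonzero operator in `∂_i` in the telescoping ideal. -/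
theorem exists_isLeadingExp_telescoping [CharZero C] (ord : MonomialOrder ξ) {J : Type*}
    [Fintype J] {I : Ideal (DOre C (ξ ⊕ τ))} (i : ξ) (a : J → ℕ) (β : J → τ →₀ ℕ)
    (hinj : ∀ x y, a x = a y → β x = β y → x = y) (c : J → MvRat C ξ) (hc : ∃ x, c x ≠ 0)
    (hI : (∑ x, Ore.term (mixedExp i (a x) (β x)) (inclX C ξ τ (c x)) : DOre C (ξ ⊕ τ)) ∈ I) :
    ∃ d, ∃ f ∈ telescoping I, Ore.IsLeadingExp ord f (Finsupp.single i d) := by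
  classical
  obtain ⟨x₁, hx₁⟩ := hc
  -- By minimality, no other `β` with a nonzero coefficient satisfies `β ≤ β₀`, so after
  -- multiplication by `t^β₀` only the terms with `β = β₀` survive modulo `derivSum`.
  obtain ⟨β₀, hβ₀⟩ := Finset.exists_minimal
    (s := (Finset.univ.filter fun x => c x ≠ 0).image β) ⟨β x₁, by
      simpa using ⟨x₁, hx₁, rfl⟩⟩
  obtain ⟨x₀, hx₀, rfl⟩ := Finset.mem_image.1 hβ₀.1
  obtain ⟨u, hu, H⟩ := exists_term_mulMonomialT_sub_mem_derivSum C ξ (β x₀)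
  set f : DOre C ξ := ∑ x ∈ Finset.univ.filter fun x => β x = β x₀,
    Ore.term (Finsupp.single i (a x)) (u * c x) with hf
  have hmem : f ∈ telescoping I := by
    have h1 := Ore.smul_mem hI (mulMonomialT 1 (β x₀))
    rw [Finset.smul_sum, ← Finset.sum_filter_add_sum_filter_not _ fun x => β x = β x₀] at h1
    simp only [Ore.smul_term, mulMonomialT_mul_inclX, one_mul, mixedExp] at h1
    have h2 : (∑ x ∈ Finset.univ.filter fun x => ¬ β x = β x₀, Ore.term
        ((β x).mapDomain Sum.inr + (Finsupp.single i (a x)).mapDomain Sum.inl)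
        (mulMonomialT (c x) (β x₀)) : DOre C (ξ ⊕ τ)) ∈ derivSum C ξ τ := by
      refine sum_mem fun x hx => ?_
      by_cases hcx : c x = 0
      · rw [hcx, mulMonomialT, map_zero, zero_mul, Ore.term_zero]
        exact zero_mem _
      · refine term_mulMonomialT_mem_derivSum (fun hle => (Finset.mem_filter.1 hx).2 ?_) _ _
        refine hle.antisymm (hβ₀.2 (Finset.mem_image_of_mem β ?_) hle)
        simpa using hcx
    have h3 : (∑ x ∈ Finset.univ.filter fun x => β x = β x₀, (Ore.term
        ((β x).mapDomain Sum.inr + (Finsupp.single i (a x)).mapDomain Sum.inl)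
        (mulMonomialT (c x) (β x₀)) - Ore.term ((Finsupp.single i (a x)).mapDomain Sum.inl)
          (inclX C ξ τ (u * c x))) : DOre C (ξ ⊕ τ)) ∈ derivSum C ξ τ := by
      refine sum_mem fun x hx => ?_
      rw [(Finset.mem_filter.1 hx).2]
      exact H _ _
    rw [Finset.sum_sub_distrib] at h3
    have h4 : inclOre f = ∑ x ∈ Finset.univ.filter fun x => β x = β x₀,
        (Ore.term ((Finsupp.single i (a x)).mapDomain Sum.inl) (inclX C ξ τ (u * c x)) :
          DOre C (ξ ⊕ τ)) := by
      rw [hf, map_sum]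
      exact Finset.sum_congr rfl fun x _ => Ore.mapHom_term _ _ _ _ _
    rw [← h4] at h3
    change inclOre f ∈ telescopingSum I
    have h5 := sub_mem
      (sub_mem (AddSubgroup.mem_sup_left h1 : _ ∈ telescopingSum I) (AddSubgroup.mem_sup_right h2))
      (AddSubgroup.mem_sup_right h3)
    rwa [add_sub_cancel_right, sub_sub_cancel] at h5
  have hne : f ≠ 0 := by
    intro h0
    have : Ore.coeffs f (Finsupp.single i (a x₀)) = u * c x₀ := by
      rw [hf, map_sum, Finsupp.finsetSum_apply, Finset.sum_eq_single x₀]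
      · rw [Ore.coeffs_term, Finsupp.single_eq_same]
      · intro x hx hne
        refine Finsupp.single_eq_of_ne' fun h => hne (hinj _ _ ?_ (Finset.mem_filter.1 hx).2)
        exact Finsupp.single_injective i |>.eq_iff.1 h
      · simp
    rw [h0, map_zero, Finsupp.zero_apply] at this
    -- Characteristic 0 enters here: the integer `u` must not vanish in the field.
    have hu' : (u : MvRat C ξ) ≠ 0 := by
      have : (algebraMap C (MvRat C ξ)) (u : C) ≠ 0 := by simpa using hu
      simpa using this
    exact mul_ne_zero hu' (Finset.mem_filter.1 hx₀).2 this.symm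
  obtain ⟨α, hα⟩ := Ore.exists_isLeadingExp ord hne
  obtain ⟨x, _, rfl⟩ := Ore.exists_eq_of_mem_support_sum_term hα.1
  exact ⟨_, f, hmem, hα⟩

/-- A pure power of every `∂_i` is a leading monomial of the telescoping ideal, which confines its
standard exponents to a finite box. -/
theorem hasHilbertDim_zero_telescoping [CharZero C] (ord : MonomialOrder (ξ ⊕ τ))
    (ord' : MonomialOrder ξ) {I : Ideal (DOre C (ξ ⊕ τ))} (hI : Ore.HasHilbertDim I 0) :
    Ore.HasHilbertDim (telescoping I) 0 := by
  classical
  have := (Ore.finite_standardExps ord (Ore.finite_of_hasHilbertDim_zero hI)).fintype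
  have H : ∀ i : ξ, ∃ d, ∃ f ∈ telescoping I, Ore.IsLeadingExp ord' f (Finsupp.single i d) := by
    intro i
    obtain ⟨n, c, hc, hmem⟩ := exists_operator_free_of_t
      (fun b : Ore.standardExps ord I => b.1) I (Ore.exists_sub_sum_mem ord I) i
    exact exists_isLeadingExp_telescoping ord' i _ _
      (fun x y h1 h2 => Prod.ext (Fin.ext h1) (boxExp_injective h2)) c hc hmem
  choose d hd using H
  refine Ore.hasHilbertDim_zero_of_finite (Ore.finite_of_finite_standardExps (ord := ord') ?_)
  refine (Set.finite_Iic (Finsupp.equivFunOnFinite.symm d)).subset fun α hα i => ?_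
  by_contra! h
  exact hα (Ore.exists_isLeadingExp_of_le (hd i) (Finsupp.single_le_iff.2 h.le))

end Telescoping

end DiffOreGrowth

theorem mainTheorem4 {C : Type*} [Field C] [CharZero C] (m k : ℕ)
    (I : Ideal (DiffOreGrowth.DOre C (Fin m ⊕ Fin k)))
    (hI : DiffOreGrowth.Ore.HasHilbertDim I 0) :
    DiffOreGrowth.HasPolynomialGrowth I 1 ∧
      DiffOreGrowth.Ore.HasHilbertDim (DiffOreGrowth.telescoping I) 0 := by
  obtain ⟨ord, hord⟩ := DiffOreGrowth.exists_isGraded (Fin m ⊕ Fin k)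
  obtain ⟨ord', _⟩ := DiffOreGrowth.exists_isGraded (Fin m)
  exact ⟨⟨ord, hord, DiffOreGrowth.hasPolynomialGrowthWrt_one ord hI⟩,
    DiffOreGrowth.hasHilbertDim_zero_telescoping ord ord' hI⟩
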